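/- **Setting.** Let $\mathfrak B$ be a $C^*$-algebra and $\mathfrak A\subset\mathfrak B$ a $^*$-subalgebra which is a Banach algebra under a norm $\|\cdot\|_{\mathfrak A}$ of its own for which the involution is continuous. Let $k\ge 2$ be an integer and $p,q>0$ real numbers with $p+q=k$. Suppose that $\mathfrak A$ is a $(k,p,q)$-differential subalgebra of $\mathfrak B$, that is, there is $C>0$ with $$\|a^k\|_{\mathfrak A}\le C\,\|a\|_{\mathfrak A}^{p}\,\|a\|_{\mathfrak B}^{q}\qquad\text{for all } a\in\mathfrak A .$$ Let $\widetilde{\mathfrak A}$ be $\mathfrak A$ if $\mathfrak A$ has a unit, and $\mathbb C\oplus\mathfrak A$ with the norm $|z|+\|a\|_{\mathfrak A}$ otherwise. Let $\mathfrak A(a)$ be the closed subalgebra of $\mathfrak A$ generated by $a$, and $\widetilde{\mathfrak A}(a,1)$ the closed subalgebra of $\widetilde{\mathfrak A}$ generated by $a$ and $1$. For $0<\tau<1$ let $\mathfrak D_\tau$ be the $^*$-algebra (pointwise operations, complex conjugation) of functions $$f(x)=\frac1{2\pi}\int_{\mathbb R}\widehat f(t)e^{itx}\,dt\quad(x\in\mathbb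 R),\qquad \widehat f\in L^1(\mathbb R),\quad \|f\|_\tau=\int_{\mathbb R}|\widehat f(t)|e^{|t|^\tau}dt<\infty ,$$ normed by $\|\cdot\|_\tau$ (the function $\widehat f$ is determined by $f$ up to null sets). **Theorem.** One has $\log_k(\max\{k-1,p\})<1$. Let $\tau\in(0,1)$ satisfy $\log_k(\max\{k-1,p\})<\tau$, and let $a=a^*\in\mathfrak A$. Then $\|e^{ita}\|_{\widetilde{\mathfrak A}}=O(e^{|t|^\tau})$ as $|t|\to\infty$, and ${\rm Spec}_{\widetilde{\mathfrak A}(a,1)}(a)\subset\mathbb R$. Moreover: 1. For every $f\in\mathfrak D_\tau$ the integral $f(a)=\frac1{2\pi}\int_{\mathbb R}\widehat f(t)e^{ita}\,dt$ exists as a Bochner integral in $\widetilde{\mathfrak A}(a,1)$. If $f(0)=0$, then $f(a)\in\mathfrak A(a)$. 2. For every $f\in\mathfrak D_\tau$ and every non-degenerate $^*$-representation $\Pi:\widetilde{\mathfrak A}(a,1)\to\mathbb B(\mathcal H)$ on a Hilbert space, $\Pi(f(a))=f(\Pi(a))$, where the right-hand side is the continuous functional calculus of the self-adjoint operator $\Pi(a)$.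 3. For every $f\in\mathfrak D_\tau$, ${\rm Spec}_{\widetilde{\mathfrak A}(a,1)}(f(a))=f\big({\rm Spec}_{\widetilde{\mathfrak A}(a,1)}(a)\big)$. 4. The map $\varphi_a:\mathfrak D_\tau\to\widetilde{\mathfrak A}(a,1)$, $\varphi_a(f)=f(a)$, is a continuous $^*$-homomorphism. For $g\in\mathfrak D_\tau$ one has $\varphi_a(g)=1$ if $g\equiv1$ on a neighborhood of ${\rm Spec}_{\widetilde{\mathfrak A}(a,1)}(a)$ in $\mathbb R$, and $\varphi_a(g)=a$ if $g(x)=x$ on a neighborhood of this spectrum. -/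

import Mathlib

namespace KPQ

open MeasureTheory WithLp
open scoped Topology

noncomputable section

/-! ### Minimal unitization -/

section MinimalUnitization

variable (A : Type*) [NonUnitalNormedRing A] [NormedSpace ℂ A] [IsScalarTower ℂ A A]
  [SMulCommClass ℂ A A]

/-- The algebra `A` has a two-sided unit. -/
def HasUnit (A : Type*) [Mul A] : Prop := ∃ e : A, ∀ x : A, e * x = x ∧ x * e = x

/-- The two-sided unit of `A`. -/
def HasUnit.unit {A : Type*} [Mul A] (h : HasUnit A) : A := Classical.choose h

theorem HasUnit.unit_spec {A : Type*} [Mul A] (h : HasUnit A) (x : A) :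
    h.unit * x = x ∧ x * h.unit = x := Classical.choose_spec h x

/-- Inside the algebra `ℂ ⊕ A` with the norm `‖(z, a)‖ = ‖z‖ + ‖a‖`, the closed subalgebra
`{(0, a)}`, an isometric copy of `A`, if `A` has a unit, and all of `ℂ ⊕ A` if `A` has no unit. -/
def minUnitizationSubalgebra : NonUnitalSubalgebra ℂ (WithLp 1 (Unitization ℂ A)) where
  carrier := {x | HasUnit A → (ofLp x).fst = 0}
  add_mem' hx hy h := by simp [hx h, hy h]
  zero_mem' _ := by simp
  mul_mem' hx hy h := by simp [hx h]
  smul_mem' c x hx h := by simp [hx h]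

/-- The minimal unitization of `A`: it is `A` itself if `A` has a unit, and `ℂ ⊕ A` with the norm
`‖(z, a)‖ = ‖z‖ + ‖a‖` otherwise. -/
def MinUnitization : Type _ := minUnitizationSubalgebra A

namespace MinUnitization

instance : NonUnitalNormedRing (MinUnitization A) :=
  inferInstanceAs (NonUnitalNormedRing (minUnitizationSubalgebra A))

instance : Module ℂ (MinUnitization A) :=
  inferInstanceAs (Module ℂ (minUnitizationSubalgebra A))

instance : NormedSpace ℂ (MinUnitization A) where
  norm_smul_le c x := norm_smul_le c x.1

variable {A}

/-- An element of `ℂ ⊕ A` as an element of the minimal unitization. -/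
def mk (x : Unitization ℂ A) (hx : HasUnit A → x.fst = 0) : MinUnitization A := ⟨toLp 1 x, hx⟩

/-- The underlying element of `ℂ ⊕ A`. -/
def val (x : MinUnitization A) : Unitization ℂ A := ofLp x.1

theorem val_injective : Function.Injective (val : MinUnitization A → Unitization ℂ A) :=
  fun _ _ h => Subtype.ext (WithLp.ofLp_injective 1 h)

variable (A) in
open Classical in
/-- The unit of the minimal unitization: the unit of `A` if there is one, and `(1, 0)` otherwise. -/
instance : One (MinUnitization A) where
  one := if h : HasUnit A then mk (h.unit : Unitization ℂ A) (fun _ => Unitization.fst_inr ℂ _)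
    else mk 1 (fun g => absurd g h)

theorem one_of_hasUnit (h : HasUnit A) :
    (1 : MinUnitization A).val = (h.unit : Unitization ℂ A) := by
  exact congrArg val (dif_pos h)

theorem one_of_not_hasUnit (h : ¬ HasUnit A) : (1 : MinUnitization A).val = 1 := by
  exact congrArg val (dif_neg h)

theorem val_smul (c : ℂ) (x : MinUnitization A) : (c • x).val = c • x.val := rfl

theorem val_mul (x y : MinUnitization A) : (x * y).val = x.val * y.val := rfl

theorem fst_eq_zero (h : HasUnit A) (x : MinUnitization A) : x.val.fst = 0 := x.2 h

theorem one_mul_mul_one (x : MinUnitization A) : 1 * x = x ∧ x * 1 = x := by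
  by_cases h : HasUnit A
  · have hx := fst_eq_zero h x
    have he := h.unit_spec x.val.snd
    refine ⟨val_injective ?_, val_injective ?_⟩ <;> rw [val_mul, one_of_hasUnit h] <;> ext <;>
      simp [hx, he.1, he.2]
  · exact ⟨val_injective (by rw [val_mul, one_of_not_hasUnit h, one_mul]),
      val_injective (by rw [val_mul, one_of_not_hasUnit h, mul_one])⟩

instance : IsScalarTower ℂ (MinUnitization A) (MinUnitization A) where
  smul_assoc c x y := Subtype.ext (smul_mul_assoc c x.1 y.1)

instance : SMulCommClass ℂ (MinUnitization A) (MinUnitization A) where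
  smul_comm c x y := Subtype.ext (mul_smul_comm c x.1 y.1).symm

instance : NormedRing (MinUnitization A) :=
  { (inferInstance : NonUnitalNormedRing (MinUnitization A)),
    (inferInstance : One (MinUnitization A)) with
    one_mul := fun x => (one_mul_mul_one x).1
    mul_one := fun x => (one_mul_mul_one x).2 }

instance : Algebra ℂ (MinUnitization A) := Algebra.ofModule smul_mul_assoc mul_smul_comm

instance : NormedAlgebra ℂ (MinUnitization A) where
  norm_smul_le c x := norm_smul_le c x.1

theorem norm_def (x : MinUnitization A) : ‖x‖ = ‖x.val.fst‖ + ‖x.val.snd‖ :=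
  unitization_norm_def x.1

theorem isClosed_minUnitizationSubalgebra :
    IsClosed (minUnitizationSubalgebra A : Set (WithLp 1 (Unitization ℂ A))) := by
  by_cases h : HasUnit A
  · have : (minUnitizationSubalgebra A : Set (WithLp 1 (Unitization ℂ A))) =
        {x | (ofLp x).fst = 0} := by
      ext x; exact ⟨fun hx => hx h, fun hx _ => hx⟩
    rw [this]
    have hc : Continuous fun x : WithLp 1 (Unitization ℂ A) => (ofLp x).fst := by
      refine LipschitzWith.continuous (K := 1) (LipschitzWith.of_dist_le_mul fun x y => ?_)
      rw [dist_eq_norm, dist_eq_norm, NNReal.coe_one, one_mul, unitization_norm_def]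
      exact le_add_of_nonneg_right (norm_nonneg _)
    exact isClosed_eq hc continuous_const
  · have : (minUnitizationSubalgebra A : Set (WithLp 1 (Unitization ℂ A))) = Set.univ := by
      ext x; exact ⟨fun _ => trivial, fun _ h' => absurd h' h⟩
    rw [this]
    exact isClosed_univ

instance [CompleteSpace A] : CompleteSpace (MinUnitization A) :=
  (isClosed_minUnitizationSubalgebra (A := A)).completeSpace_coe

section Star

variable [StarRing A]

/-- The involution `(z, a)* = (conj z, a*)`. -/
instance : Star (MinUnitization A) where
  star x := mk (star x.val) (fun h => by simp [fst_eq_zero h x])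

theorem val_star (x : MinUnitization A) : (star x).val = star x.val := rfl

instance [StarModule ℂ A] : StarRing (MinUnitization A) where
  star_involutive x := val_injective (star_star x.val)
  star_mul x y := val_injective (star_mul x.val y.val)
  star_add x y := val_injective (star_add x.val y.val)

instance [StarModule ℂ A] : StarModule ℂ (MinUnitization A) where
  star_smul c x := val_injective (by
    rw [val_star, val_smul, val_smul, val_star, star_smul])

instance [ContinuousStar A] : ContinuousStar (MinUnitization A) where
  continuous_star := by
    have hs : Continuous fun x : MinUnitization A => star x.val.snd := by
      refine continuous_star.comp
        (LipschitzWith.continuous (K := 1) (LipschitzWith.of_dist_le_mul fun x y => ?_))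
      rw [dist_eq_norm, dist_eq_norm, NNReal.coe_one, one_mul, norm_def]
      exact le_add_of_nonneg_left (norm_nonneg _)
    have hf : Continuous fun x : MinUnitization A => star x.val.fst := by
      refine continuous_star.comp
        (LipschitzWith.continuous (K := 1) (LipschitzWith.of_dist_le_mul fun x y => ?_))
      rw [dist_eq_norm, dist_eq_norm, NNReal.coe_one, one_mul, norm_def]
      exact le_add_of_nonneg_right (norm_nonneg _)
    rw [continuous_iff_continuousAt]
    intro x
    rw [ContinuousAt, tendsto_iff_norm_sub_tendsto_zero]
    have h1 := tendsto_iff_norm_sub_tendsto_zero.1 (hf.tendsto x)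
    have h2 := tendsto_iff_norm_sub_tendsto_zero.1 (hs.tendsto x)
    have h3 := h1.add h2
    rw [add_zero] at h3
    refine h3.congr fun y => ?_
    rw [norm_def]
    rfl

variable (A) in
/-- The canonical embedding of `A` in its minimal unitization. -/
def of : A →⋆ₙₐ[ℂ] MinUnitization A where
  toFun a := mk (a : Unitization ℂ A) (fun _ => Unitization.fst_inr ℂ a)
  map_zero' := val_injective (Unitization.inr_zero ℂ)
  map_add' a b := val_injective (Unitization.inr_add ℂ a b)
  map_mul' a b := val_injective (Unitization.inr_mul ℂ a b)
  map_smul' c a := val_injective (by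
    exact Unitization.inr_smul ℂ c a)
  map_star' a := val_injective (Unitization.inr_star a)

theorem norm_of (a : A) : ‖of A a‖ = ‖a‖ := unitization_norm_inr a

theorem of_surjective (h : HasUnit A) : Function.Surjective (of A) := fun x =>
  ⟨x.val.snd, val_injective (by
    ext
    · exact (fst_eq_zero h x).symm
    · rfl)⟩

end Star

end MinUnitization

end MinimalUnitization

/-! ### The closed subalgebra generated by `a` and `1` -/

section Generated

variable {U : Type*} [NormedRing U] [NormedAlgebra ℂ U] [StarRing U] [StarModule ℂ U]
  [ContinuousStar U]

/-- For self-adjoint `x` the closed star subalgebra generated by `x` and `1` is the closed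
subalgebra generated by `x` and `1`. -/
theorem elemental_toSubalgebra {x : U} (hx : IsSelfAdjoint x) :
    (StarAlgebra.elemental ℂ x).toSubalgebra = Algebra.elemental ℂ x := by
  apply le_antisymm
  · let S : StarSubalgebra ℂ U :=
      { Algebra.elemental ℂ x with
        star_mem' := by
          intro y hy
          have h1 : ∀ y ∈ Algebra.adjoin ℂ {x}, star y ∈ Algebra.adjoin ℂ {x} := by
            intro y hy
            induction hy using Algebra.adjoin_induction with
            | mem z hz =>
              rw [Set.mem_singleton_iff.1 hz, hx.star_eq]
              exact Algebra.self_mem_adjoin_singleton ℂ x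
            | algebraMap r =>
              rw [← algebraMap_star_comm]
              exact Subalgebra.algebraMap_mem _ _
            | add y z _ _ h1 h2 => rw [star_add]; exact add_mem h1 h2
            | mul y z _ _ h1 h2 => rw [star_mul]; exact mul_mem h2 h1
          exact map_mem_closure continuous_star hy h1 }
    have : StarAlgebra.elemental ℂ x ≤ S :=
      StarAlgebra.elemental.le_of_mem (Algebra.elemental.isClosed ℂ x)
        (Algebra.elemental.self_mem ℂ x)
    exact this
  · exact Algebra.elemental.le_of_mem (StarAlgebra.elemental.isClosed ℂ x)
      (StarAlgebra.elemental.self_mem ℂ x)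

end Generated

/-! ### The function algebra `𝔇_τ` -/

section FunctionAlgebra

open Real in
/-- `f` is the function `f(x) = (1/2π) ∫ F(t) e^{itx} dt` with `F ∈ L¹(ℝ)` and
`∫ |F(t)| e^{|t|^τ} dt < ∞`. -/
structure IsTauRep (τ : ℝ) (f F : ℝ → ℂ) : Prop where
  integrable : Integrable F
  weighted : Integrable (fun t : ℝ => ‖F t‖ * Real.exp (|t| ^ τ))
  eq_integral : ∀ x : ℝ,
    f x = (1 / (2 * π) : ℂ) * ∫ t : ℝ, F t * Complex.exp (Complex.I * t * x)

namespace IsTauRep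

open scoped FourierTransform Convolution

variable {τ : ℝ} {f g F G : ℝ → ℂ}

theorem integral_eq_fourier (F : ℝ → ℂ) (x : ℝ) :
    ∫ t : ℝ, F t * Complex.exp (Complex.I * t * x) = 𝓕 F (-(x / (2 * Real.pi))) := by
  rw [Real.fourier_real_eq_integral_exp_smul]
  refine integral_congr_ae (Filter.Eventually.of_forall fun t => ?_)
  simp only [smul_eq_mul]
  rw [mul_comm]
  congr 2
  push_cast
  have : (Real.pi : ℂ) ≠ 0 := by exact_mod_cast Real.pi_ne_zero
  field_simp

theorem eq_fourier (h : IsTauRep τ f F) (x : ℝ) :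
    f x = (1 / (2 * Real.pi) : ℂ) * 𝓕 F (-(x / (2 * Real.pi))) := by
  rw [h.eq_integral, integral_eq_fourier]

theorem integrable_mul_exp (hF : Integrable F) (x : ℝ) :
    Integrable fun t : ℝ => F t * Complex.exp (Complex.I * t * x) := by
  refine hF.mul_bdd (c := 1) (by fun_prop) (Filter.Eventually.of_forall fun t => ?_)
  have : Complex.I * t * x = ((t * x : ℝ) : ℂ) * Complex.I := by push_cast; ring
  rw [this, Complex.norm_exp_ofReal_mul_I]

theorem aesm_weight (τ : ℝ) :
    AEStronglyMeasurable (fun t : ℝ => Real.exp (|t| ^ τ)) volume := by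
  have : Measurable fun t : ℝ => |t| ^ τ := (measurable_id.abs).pow_const τ
  exact (Real.measurable_exp.comp this).aestronglyMeasurable

theorem zero : IsTauRep τ 0 0 := ⟨integrable_zero _ _ _, by simp, by simp⟩

theorem add (hf : IsTauRep τ f F) (hg : IsTauRep τ g G) : IsTauRep τ (f + g) (F + G) where
  integrable := hf.integrable.add hg.integrable
  weighted := by
    refine (hf.weighted.add hg.weighted).mono'
      ((hf.integrable.add hg.integrable).aestronglyMeasurable.norm.mul
        (aesm_weight τ)) (Filter.Eventually.of_forall fun t => ?_)
    have h0 := (Real.exp_pos (|t| ^ τ)).le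
    rw [Real.norm_of_nonneg (mul_nonneg (norm_nonneg _) h0)]
    simp only [Pi.add_apply, ← add_mul]
    exact mul_le_mul_of_nonneg_right (norm_add_le _ _) h0
  eq_integral x := by
    simp only [Pi.add_apply, add_mul]
    rw [integral_add (integrable_mul_exp hf.integrable x) (integrable_mul_exp hg.integrable x),
      hf.eq_integral, hg.eq_integral, mul_add]

theorem smul (c : ℂ) (hf : IsTauRep τ f F) : IsTauRep τ (c • f) (c • F) where
  integrable := hf.integrable.smul c
  weighted := by
    simp only [Pi.smul_apply, norm_smul, mul_assoc]
    exact hf.weighted.const_mul _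
  eq_integral x := by
    simp only [Pi.smul_apply, smul_eq_mul, mul_assoc c]
    rw [integral_const_mul, hf.eq_integral]
    ring

theorem star (hf : IsTauRep τ f F) :
    IsTauRep τ (star f) (fun t => starRingEnd ℂ (F (-t))) where
  integrable := by
    have := hf.integrable.comp_neg
    exact (Complex.conjCLE : ℂ →L[ℝ] ℂ).integrable_comp this
  weighted := by
    have := hf.weighted.comp_neg
    simpa using this
  eq_integral x := by
    rw [← integral_neg_eq_self]
    simp only [Pi.star_apply, neg_neg, RCLike.star_def]
    rw [hf.eq_integral, map_mul, ← integral_conj]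
    congr 1
    · rw [map_div₀, map_mul, map_one, Complex.conj_ofReal, Complex.conj_ofNat]
    · refine integral_congr_ae (Filter.Eventually.of_forall fun t => ?_)
      simp only [map_mul, ← Complex.exp_conj, Complex.conj_I, Complex.conj_ofReal]
      push_cast
      ring_nf

theorem mul (h0 : 0 < τ) (h1 : τ < 1) (hf : IsTauRep τ f F) (hg : IsTauRep τ g G) :
    IsTauRep τ (f * g)
      ((1 / (2 * Real.pi) : ℂ) • (F ⋆[ContinuousLinearMap.mul ℂ ℂ, volume] G)) where
  integrable := (hf.integrable.integrable_convolution _ hg.integrable).smul _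
  weighted := by
    simp only [Pi.smul_apply, norm_smul, mul_assoc]
    refine Integrable.const_mul ?_ _
    have hi := hf.integrable.integrable_convolution (ContinuousLinearMap.mul ℂ ℂ) hg.integrable
    have hw := hf.weighted.integrable_convolution (ContinuousLinearMap.mul ℝ ℝ) hg.weighted
    have he := hf.weighted.ae_convolution_exists (ContinuousLinearMap.mul ℝ ℝ) hg.weighted
    refine hw.mono' (hi.aestronglyMeasurable.norm.mul (aesm_weight τ)) ?_
    filter_upwards [he] with t ht
    have hp := (Real.exp_pos (|t| ^ τ)).le
    rw [Real.norm_of_nonneg (mul_nonneg (norm_nonneg _) hp)]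
    calc ‖(F ⋆[ContinuousLinearMap.mul ℂ ℂ, volume] G) t‖ * Real.exp (|t| ^ τ)
        ≤ (∫ s, ‖F s * G (t - s)‖) * Real.exp (|t| ^ τ) := by
          refine mul_le_mul_of_nonneg_right ?_ hp
          exact norm_integral_le_integral_norm _
      _ = ∫ s, ‖F s * G (t - s)‖ * Real.exp (|t| ^ τ) := (integral_mul_const _ _).symm
      _ ≤ _ := by
          refine integral_mono_of_nonneg
            (Filter.Eventually.of_forall fun s => mul_nonneg (norm_nonneg _) hp) ht
            (Filter.Eventually.of_forall fun s => ?_)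
          simp only [ContinuousLinearMap.mul_apply', norm_mul]
          have hs : |t| ^ τ ≤ |s| ^ τ + |t - s| ^ τ := by
            refine le_trans (Real.rpow_le_rpow (abs_nonneg _) ?_ h0.le)
              (Real.rpow_add_le_add_rpow (abs_nonneg _) (abs_nonneg _) h0.le h1.le)
            calc |t| = |s + (t - s)| := by ring_nf
              _ ≤ _ := abs_add_le _ _
          calc ‖F s‖ * ‖G (t - s)‖ * Real.exp (|t| ^ τ)
              ≤ ‖F s‖ * ‖G (t - s)‖ * Real.exp (|s| ^ τ + |t - s| ^ τ) := by gcongr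
            _ = _ := by rw [Real.exp_add]; ring
  eq_integral x := by
    rw [integral_eq_fourier, Pi.mul_apply, hf.eq_fourier, hg.eq_fourier]
    have : 𝓕 ((1 / (2 * Real.pi) : ℂ) • (F ⋆[ContinuousLinearMap.mul ℂ ℂ, volume] G)) =
        (1 / (2 * Real.pi) : ℂ) • 𝓕 (F ⋆[ContinuousLinearMap.mul ℂ ℂ, volume] G) := by
      ext y
      rw [Pi.smul_apply, Real.fourier_real_eq, Real.fourier_real_eq, ← integral_smul]
      refine integral_congr_ae (Filter.Eventually.of_forall fun t => ?_)
      simp only [Pi.smul_apply, Circle.smul_def]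
      exact smul_comm _ _ _
    rw [this, Pi.smul_apply, Real.fourier_mul_convolution_eq hf.integrable hg.integrable]
    simp only [smul_eq_mul]
    ring

/-- The function `F` is determined by `f` almost everywhere. -/
theorem ae_eq (hF : IsTauRep τ f F) (hG : IsTauRep τ f G) : F =ᵐ[volume] G := by
  have hsub : 𝓕 F = 𝓕 G := by
    ext y
    have h := (hF.eq_fourier (-(2 * Real.pi * y))).symm.trans
      (hG.eq_fourier (-(2 * Real.pi * y)))
    have hpi : (1 / (2 * Real.pi) : ℂ) ≠ 0 := by
      have : (Real.pi : ℂ) ≠ 0 := by exact_mod_cast Real.pi_ne_zero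
      simp [this]
    have h2 := mul_left_cancel₀ hpi h
    have h3 : -(-(2 * Real.pi * y) / (2 * Real.pi)) = y := by
      field_simp
    rwa [h3] at h2
  refine ae_eq_of_integral_contDiff_smul_eq hF.integrable.locallyIntegrable
    hG.integrable.locallyIntegrable fun u hu hc => ?_
  let v : SchwartzMap ℝ ℂ := (hc.comp_left (g := ((↑) : ℝ → ℂ)) rfl).toSchwartzMap
    (Complex.ofRealCLM.contDiff.comp hu)
  have hv : ∀ x, v x = (u x : ℂ) := fun x => rfl
  have key : ∀ H : ℝ → ℂ, Integrable H → ∫ x, u x • H x = ∫ ξ, 𝓕 H ξ * (𝓕⁻ v : SchwartzMap ℝ ℂ) ξ := by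
    intro H hH
    have h := VectorFourier.integral_fourierIntegral_smul_eq_flip (μ := volume) (ν := volume)
      (e := Real.fourierChar) (L := innerₗ ℝ) Real.continuous_fourierChar continuous_inner
      hH (𝓕⁻ v : SchwartzMap ℝ ℂ).integrable
    have h1 : VectorFourier.fourierIntegral Real.fourierChar volume (innerₗ ℝ) H = 𝓕 H := rfl
    have h2 : VectorFourier.fourierIntegral Real.fourierChar volume (innerₗ ℝ).flip
        ((𝓕⁻ v : SchwartzMap ℝ ℂ) : ℝ → ℂ) = (v : ℝ → ℂ) := by
      rw [flip_innerₗ]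
      change 𝓕 ((𝓕⁻ v : SchwartzMap ℝ ℂ) : ℝ → ℂ) = _
      rw [← SchwartzMap.fourier_coe, FourierTransform.fourier_fourierInv_eq]
    rw [h1, h2] at h
    simp only [smul_eq_mul] at h
    rw [h]
    refine integral_congr_ae (Filter.Eventually.of_forall fun t => ?_)
    simp only [hv, Complex.real_smul]
    exact mul_comm _ _
  rw [key F hF.integrable, key G hG.integrable, hsub]

end IsTauRep

/-- The functions `f` on the real line with a representation `f(x) = (1/2π) ∫ f̂(t) e^{itx} dt`, where
`f̂ ∈ L¹(ℝ)` and `∫ |f̂(t)| e^{|t|^τ} dt < ∞`, as an algebra under pointwise operations. -/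
def dTauSubalgebra (τ : Set.Ioo (0 : ℝ) 1) : NonUnitalStarSubalgebra ℂ (ℝ → ℂ) where
  carrier := {f | ∃ F : ℝ → ℂ, IsTauRep τ f F}
  add_mem' := fun ⟨_, hF⟩ ⟨_, hG⟩ => ⟨_, hF.add hG⟩
  zero_mem' := ⟨_, IsTauRep.zero⟩
  mul_mem' := fun ⟨_, hF⟩ ⟨_, hG⟩ => ⟨_, IsTauRep.mul τ.2.1 τ.2.2 hF hG⟩
  smul_mem' := fun c _ ⟨_, hF⟩ => ⟨_, hF.smul c⟩
  star_mem' := fun ⟨_, hF⟩ => ⟨_, hF.star⟩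

/-- The algebra `𝔇_τ` as a type of its own, since it carries the norm `‖f‖_τ` and not the topology
of pointwise convergence. -/
def DTau (τ : Set.Ioo (0 : ℝ) 1) : Type := dTauSubalgebra τ

namespace DTau

variable {τ : Set.Ioo (0 : ℝ) 1}

instance : NonUnitalCommRing (DTau τ) := inferInstanceAs (NonUnitalCommRing (dTauSubalgebra τ))

instance : Module ℂ (DTau τ) := inferInstanceAs (Module ℂ (dTauSubalgebra τ))

instance : StarRing (DTau τ) := inferInstanceAs (StarRing (dTauSubalgebra τ))

/-- Elements of `𝔇_τ` are functions on the real line. -/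
instance : CoeFun (DTau τ) (fun _ => ℝ → ℂ) := ⟨fun f => f.1⟩

/-- The function `f̂`; it is unique up to equality almost everywhere. -/
def hat (f : DTau τ) : ℝ → ℂ := Classical.choose f.2

theorem isTauRep_hat (f : DTau τ) : IsTauRep τ f f.hat := Classical.choose_spec f.2

/-- The norm `‖f‖_τ = ∫ |f̂(t)| e^{|t|^τ} dt`. -/
instance : Norm (DTau τ) := ⟨fun f => ∫ t : ℝ, ‖f.hat t‖ * Real.exp (|t| ^ (τ : ℝ))⟩

theorem norm_def (f : DTau τ) : ‖f‖ = ∫ t : ℝ, ‖f.hat t‖ * Real.exp (|t| ^ (τ : ℝ)) := rfl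

theorem norm_eq {f : DTau τ} {F : ℝ → ℂ} (h : IsTauRep τ f F) :
    ‖f‖ = ∫ t : ℝ, ‖F t‖ * Real.exp (|t| ^ (τ : ℝ)) := by
  refine integral_congr_ae ?_
  filter_upwards [f.isTauRep_hat.ae_eq h] with t ht
  rw [ht]

theorem norm_smul_eq (c : ℂ) (f : DTau τ) : ‖c • f‖ = ‖c‖ * ‖f‖ := by
  have h : IsTauRep τ (c • f : DTau τ) (c • f.hat) := f.isTauRep_hat.smul c
  rw [norm_eq h, norm_def, ← integral_const_mul]
  simp only [Pi.smul_apply, norm_smul, mul_assoc]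

theorem norm_add_le' (f g : DTau τ) : ‖f + g‖ ≤ ‖f‖ + ‖g‖ := by
  have h : IsTauRep τ (f + g : DTau τ) (f.hat + g.hat) := f.isTauRep_hat.add g.isTauRep_hat
  rw [norm_eq h, norm_def, norm_def,
    ← integral_add f.isTauRep_hat.weighted g.isTauRep_hat.weighted]
  refine integral_mono h.weighted (f.isTauRep_hat.weighted.add g.isTauRep_hat.weighted)
    fun t => ?_
  simp only [Pi.add_apply, ← add_mul]
  exact mul_le_mul_of_nonneg_right (norm_add_le _ _) (Real.exp_pos _).le

theorem eq_zero_of_norm_eq_zero (f : DTau τ) (h : ‖f‖ = 0) : f = 0 := by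
  rw [norm_def, integral_eq_zero_iff_of_nonneg
    (fun t => mul_nonneg (norm_nonneg _) (Real.exp_pos _).le) f.isTauRep_hat.weighted] at h
  have h2 : f.hat =ᵐ[volume] 0 := by
    filter_upwards [h] with t ht
    have := (mul_eq_zero.1 ht).resolve_right (Real.exp_pos _).ne'
    exact norm_eq_zero.1 this
  apply Subtype.ext
  funext x
  rw [f.isTauRep_hat.eq_integral]
  have : ∫ t : ℝ, f.hat t * Complex.exp (Complex.I * t * x) = 0 := by
    rw [← integral_zero ℝ ℂ (μ := volume)]
    refine integral_congr_ae ?_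
    filter_upwards [h2] with t ht
    rw [ht]; simp
  rw [this, mul_zero]
  rfl

instance : NormedAddCommGroup (DTau τ) :=
  AddGroupNorm.toNormedAddCommGroup
    { toFun := fun f => ‖f‖
      map_zero' := by simpa using norm_smul_eq 0 (0 : DTau τ)
      add_le' := norm_add_le'
      neg' := fun f => by simpa using norm_smul_eq (-1) f
      eq_zero_of_map_eq_zero' := eq_zero_of_norm_eq_zero }

instance : NormedSpace ℂ (DTau τ) where
  norm_smul_le c f := (norm_smul_eq c f).le

end DTau

end FunctionAlgebra

/-! ### Differential subalgebras -/

/-- `nuPow a n` is `a ^ n` for `1 ≤ n` in an algebra that need not have a unit (and `0` for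
`n = 0`). -/
def nuPow {A : Type*} [NonUnitalRing A] (a : A) : ℕ → A
  | 0 => 0
  | 1 => a
  | n + 2 => nuPow a (n + 1) * a

/-- `A`, embedded by `ι` as a star subalgebra of `B` and complete for a norm of its own, is a
`(k, p, q)`-differential subalgebra of `B`. -/
structure IsDifferentialSubalgebra {A B : Type*} [NonUnitalNormedRing A] [NormedSpace ℂ A]
    [StarRing A] [NonUnitalCStarAlgebra B] (k : ℕ) (p q : ℝ) (ι : A →⋆ₙₐ[ℂ] B) : Prop where
  injective : Function.Injective ι
  two_le : 2 ≤ k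
  p_pos : 0 < p
  q_pos : 0 < q
  add_eq : p + q = k
  bound : ∃ C : ℝ, 0 < C ∧ ∀ a : A, ‖nuPow a k‖ ≤ C * ‖a‖ ^ p * ‖ι a‖ ^ q

/-! ### The functional calculus -/

section Calculus

variable {A : Type*} [NonUnitalNormedRing A] [NormedSpace ℂ A] [IsScalarTower ℂ A A]
  [SMulCommClass ℂ A A] [StarRing A] [StarModule ℂ A] [ContinuousStar A]

/-- The closed (star) subalgebra of the minimal unitization of `A` generated by `a` and `1`; see
`elemental_toSubalgebra`. -/
abbrev Gen (a : A) : Type _ := StarAlgebra.elemental ℂ (MinUnitization.of A a)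

/-- The element `a` of `Gen a`. -/
def gen (a : A) : Gen a := ⟨MinUnitization.of A a, StarAlgebra.elemental.self_mem ℂ _⟩

/-- The element `e^{ita}`. -/
def expI (a : A) (t : ℝ) : Gen a := NormedSpace.exp ((Complex.I * t) • gen a)

/-- The element `f(a) = (1/2π) ∫ f̂(t) e^{ita} dt` (a Bochner integral). -/
def funCalc {τ : Set.Ioo (0 : ℝ) 1} (f : DTau τ) (a : A) : Gen a :=
  (1 / (2 * Real.pi) : ℂ) • ∫ t : ℝ, f.hat t • expI a t

/-- The real points of the spectrum of `a` in the closed subalgebra generated by `a` and `1`. -/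
def realSpec (a : A) : Set ℝ := {x : ℝ | (x : ℂ) ∈ spectrum ℂ (gen a)}

end Calculus

/-- The representation `rep` is non-degenerate: the vectors `rep x v` span a dense subspace. -/
def IsNondegenerate {E H : Type*} [NormedAddCommGroup H] [InnerProductSpace ℂ H]
    (rep : E → (H →L[ℂ] H)) : Prop :=
  (Submodule.span ℂ {w : H | ∃ (x : E) (v : H), w = rep x v}).topologicalClosure = ⊤

end

end KPQ

open KPQ
open scoped Topology

/-!
Write `u(t) = e^{ita}` for a self-adjoint `a`. Everything rests on one estimate, the growth
`‖u(t)‖ = O(e^{|t|^τ})`, which is `exists_norm_expI_le`.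

**Growth.** The algebra `A` need not contain `u(t)`, but it contains `v(t) = u(t) - 1`
(`exists_of_eq_expI_sub_one`). Since `u(t)` is unitary, the `C*`-identity gives `‖v(t)‖ ≤ 2` in
`B`, and the differential inequality becomes `‖v(t)^k‖ ≤ C 2^q ‖v(t)‖^p`. Expanding
`(u(t) - 1)^k` by the binomial theorem and using `u(t)^i = u(it)`, one gets
`‖v(kt)‖ ≤ C 2^q ‖v(t)‖^p + ∑_{i<k} binom(k, i) ‖v(it)‖`. For `σ > 0` with `p < k^σ`, a bound
`e^{K|t|^σ}` reproduces itself under this recursion, because both `p` and `(k - 1)^σ` are smaller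
than `k^σ` (`exists_le_exp_of_recursion`). Choosing `σ` slightly smaller than `τ` absorbs the
constant `K` (`exists_exp_max_rpow_le`). The argument does not distinguish whether `A` has a unit.

**Consequences.** The integrals `f(a)` converge absolutely. Multiplicativity of `u` turns
convolution of densities into products (`fourierCalc_convolution`), so `f ↦ f(a)` is a
`*`-homomorphism. If `f(0) = 0`, then `∫ f̂ = 0`, and `u(t)` may be replaced by `v(t)` in the
integral, which then lies in `A`. A continuous homomorphism `φ` satisfies
`φ(f(a)) = (1/2π) ∫ f̂(t) e^{itφ(a)} dt` (`map_fourierCalc`). Three cases of this give the rest: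

* `φ` a character of the commutative Banach algebra generated by `a` and `1`: subexponential growth
  makes `φ(a)` real, and Gelfand theory gives the spectral mapping theorem;
* `φ` a representation, which is automatically continuous (`continuous_of_starAlgHom`);
* `φ` the functional calculus `C(Spec T) → 𝔹(H)` of `T = Π(a)`, which identifies the integral formed
  with `T` as `f(T)` (`fourierCalc_eq_cfc`).

Finally, the algebra generated by `a` and `1` embeds in the `C*`-algebra `ℂ ⊕ B`, hence is
semisimple (`eq_zero_of_forall_algHom_eq_zero`), so `f(a)` is determined by the values of `f` on the
spectrum of `a`; this identifies `f(a)` when `f = 1` or `f(x) = x` there.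
-/

namespace KPQ

open MeasureTheory Filter
open scoped Topology

/-! ### Growth of a function satisfying a multiplicative recursion -/

/-- The recursion bounds the value at `k t` by the values at `t` and at `i t` with `i < k`. Since `p < k ^ τ` and `(k - 1) ^ τ < k ^ τ`, the bound `exp (K |t| ^ τ)`
reproduces itself on the scale `|t| ↦ k |t| / (k - 1)`, once `|t|` is so large that the constant
`C + 2 ^ k` is absorbed. -/
theorem exists_le_exp_of_recursion {k : ℕ} (hk : 2 ≤ k) {p τ C : ℝ} (hp : 0 < p) (hτ : 0 < τ)
    (hpτ : p < (k : ℝ) ^ τ) (hC : 0 ≤ C) {N : ℝ → ℝ} (hN : ∀ t, 0 ≤ N t) (hc : Continuous N)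
    (hrec : ∀ t : ℝ, N (k * t) ≤
      C * N t ^ p + ∑ i ∈ Finset.range k, (k.choose i : ℝ) * N (i * t)) :
    ∃ K : ℝ, ∀ t, N t ≤ Real.exp (K * max 1 |t| ^ τ) := by
  have hk2 : (2 : ℝ) ≤ k := by exact_mod_cast hk
  have hk1 : (1 : ℝ) ≤ k - 1 := by linarith
  set m : ℝ := max p (((k : ℝ) - 1) ^ τ) with hm
  have hmk : m < (k : ℝ) ^ τ :=
    max_lt hpτ (Real.rpow_lt_rpow (by linarith) (by linarith) hτ)
  set δ : ℝ := (k : ℝ) ^ τ - m with hδ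
  have hδ0 : 0 < δ := sub_pos.2 hmk
  set L : ℝ := C + 2 ^ k with hL
  have hL0 : 0 < L := by positivity
  -- beyond `t₀` the constant `L` is absorbed by the gap `δ`
  obtain ⟨t₀, ht₀1, ht₀⟩ : ∃ t₀ : ℝ, 1 ≤ t₀ ∧ ∀ s, t₀ ≤ s → L ≤ Real.exp (δ * s ^ τ) := by
    have h : Tendsto (fun s : ℝ => Real.exp (δ * s ^ τ)) atTop atTop :=
      Real.tendsto_exp_atTop.comp ((tendsto_rpow_atTop hτ).const_mul_atTop hδ0)
    obtain ⟨t₀, h0⟩ := eventually_atTop.1 ((h.eventually_ge_atTop L).and (eventually_ge_atTop 1))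
    exact ⟨t₀, (h0 t₀ le_rfl).2, fun s hs => (h0 s hs).1⟩
  obtain ⟨M, hM⟩ : ∃ M : ℝ, ∀ t ∈ Set.Icc (-(k * t₀)) (k * t₀), N t ≤ M := by
    obtain ⟨M, hM⟩ := (isCompact_Icc.image hc).bddAbove
    exact ⟨M, fun t ht => hM ⟨t, ht, rfl⟩⟩
  set K : ℝ := max 1 M with hK
  have hK1 : 1 ≤ K := le_max_left _ _
  have hK0 : 0 ≤ K := by linarith
  have hbase : ∀ t : ℝ, |t| ≤ k * t₀ → N t ≤ Real.exp (K * max 1 |t| ^ τ) := by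
    intro t ht
    have h1 : (1 : ℝ) ≤ max 1 |t| ^ τ := Real.one_le_rpow (le_max_left _ _) hτ.le
    calc N t ≤ M := hM t (abs_le.1 ht)
      _ ≤ K := le_max_right _ _
      _ ≤ K * max 1 |t| ^ τ := le_mul_of_one_le_right hK0 h1
      _ ≤ _ := by linarith [Real.add_one_le_exp (K * max 1 |t| ^ τ)]
  have hstep : ∀ R : ℝ, (∀ t : ℝ, |t| ≤ R → N t ≤ Real.exp (K * max 1 |t| ^ τ)) →
      ∀ t : ℝ, |t| ≤ k / (k - 1) * R → N t ≤ Real.exp (K * max 1 |t| ^ τ) := by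
    intro R hR t ht
    by_cases hsmall : |t| ≤ k * t₀
    · exact hbase t hsmall
    push Not at hsmall
    set s : ℝ := t / k with hs
    have hts : t = k * s := by rw [hs]; field_simp
    have hat : |t| = k * |s| := by rw [hts, abs_mul, abs_of_pos (by linarith : (0 : ℝ) < k)]
    have hs0 : t₀ ≤ |s| := by
      rw [hat] at hsmall
      exact (lt_of_mul_lt_mul_left hsmall (by linarith)).le
    have hs1 : 1 ≤ |s| := ht₀1.trans hs0
    have hsR : (k - 1) * |s| ≤ R := by
      rw [hat, div_mul_eq_mul_div, le_div_iff₀ (by linarith)] at ht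
      nlinarith
    have hsτ : 0 ≤ |s| ^ τ := Real.rpow_nonneg (abs_nonneg _) _
    set X : ℝ := Real.exp (K * (m * |s| ^ τ)) with hX
    have hpow : N s ^ p ≤ X := by
      have h1 : N s ≤ Real.exp (K * |s| ^ τ) := by
        have := hR s (le_trans (by nlinarith) hsR)
        rwa [max_eq_right hs1] at this
      calc N s ^ p ≤ Real.exp (K * |s| ^ τ) ^ p := Real.rpow_le_rpow (hN s) h1 hp.le
        _ = Real.exp (K * (p * |s| ^ τ)) := by rw [← Real.exp_mul]; ring_nf
        _ ≤ X := Real.exp_le_exp.2 (mul_le_mul_of_nonneg_left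
              (mul_le_mul_of_nonneg_right (le_max_left _ _) hsτ) hK0)
    have hlow : ∀ i ∈ Finset.range k, N (i * s) ≤ X := by
      intro i hi
      have hik : (i : ℝ) ≤ k - 1 := by
        have : i + 1 ≤ k := Finset.mem_range.1 hi
        have : (i : ℝ) + 1 ≤ k := by exact_mod_cast this
        linarith
      have his : |(i : ℝ) * s| ≤ (k - 1) * |s| := by
        rw [abs_mul, abs_of_nonneg (Nat.cast_nonneg i)]
        exact mul_le_mul_of_nonneg_right hik (abs_nonneg _)
      have h1 : max 1 |(i : ℝ) * s| ≤ (k - 1) * |s| := max_le (by nlinarith) his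
      refine (hR _ (his.trans hsR)).trans
        (Real.exp_le_exp.2 (mul_le_mul_of_nonneg_left ?_ hK0))
      calc max 1 |(i : ℝ) * s| ^ τ ≤ ((k - 1) * |s|) ^ τ :=
            Real.rpow_le_rpow (by positivity) h1 hτ.le
        _ = (k - 1) ^ τ * |s| ^ τ := Real.mul_rpow (by linarith) (abs_nonneg _)
        _ ≤ m * |s| ^ τ := mul_le_mul_of_nonneg_right (le_max_right _ _) hsτ
    have hsum : ∑ i ∈ Finset.range k, (k.choose i : ℝ) * N (i * s) ≤ 2 ^ k * X := by
      calc ∑ i ∈ Finset.range k, (k.choose i : ℝ) * N (i * s)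
          ≤ ∑ i ∈ Finset.range k, (k.choose i : ℝ) * X :=
            Finset.sum_le_sum fun i hi =>
              mul_le_mul_of_nonneg_left (hlow i hi) (Nat.cast_nonneg _)
        _ ≤ ∑ i ∈ Finset.range (k + 1), (k.choose i : ℝ) * X :=
            Finset.sum_le_sum_of_subset_of_nonneg
              (Finset.range_mono (Nat.le_succ k)) fun _ _ _ => by positivity
        _ = 2 ^ k * X := by
            rw [← Finset.sum_mul]
            congr 1
            exact_mod_cast Nat.sum_range_choose k
    rw [max_eq_right (by nlinarith : 1 ≤ |t|), hat]
    calc N t = N (k * s) := by rw [← hts]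
      _ ≤ C * N s ^ p + ∑ i ∈ Finset.range k, (k.choose i : ℝ) * N (i * s) := hrec s
      _ ≤ C * X + 2 ^ k * X := add_le_add (mul_le_mul_of_nonneg_left hpow hC) hsum
      _ = L * X := by rw [hL]; ring
      _ ≤ Real.exp (K * (δ * |s| ^ τ)) * X := by
          refine mul_le_mul_of_nonneg_right ((ht₀ _ hs0).trans (Real.exp_le_exp.2 ?_))
            (Real.exp_pos _).le
          exact le_mul_of_one_le_left (mul_nonneg hδ0.le hsτ) hK1
      _ = Real.exp (K * (k * |s|) ^ τ) := by
          rw [hX, ← Real.exp_add, Real.mul_rpow (by linarith) (abs_nonneg _), hδ]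
          ring_nf
  have hall : ∀ n : ℕ, ∀ t : ℝ, |t| ≤ ((k : ℝ) / (k - 1)) ^ n * (k * t₀) →
      N t ≤ Real.exp (K * max 1 |t| ^ τ) := by
    intro n
    induction n with
    | zero => simpa using hbase
    | succ n ih =>
      intro t ht
      refine hstep _ ih t ?_
      rwa [pow_succ', mul_assoc] at ht
  refine ⟨K, fun t => ?_⟩
  have hr : 1 < (k : ℝ) / (k - 1) := by rw [one_lt_div (by linarith)]; linarith
  obtain ⟨n, hn⟩ := pow_unbounded_of_one_lt |t| hr
  refine hall n t (hn.le.trans (le_mul_of_one_le_right (by positivity) ?_))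
  nlinarith

/-- A larger exponent absorbs the constant in front of a smaller one. -/
theorem exists_exp_max_rpow_le {σ τ : ℝ} (hσ : 0 < σ) (hστ : σ < τ) (hτ1 : τ ≤ 1) (K : ℝ) :
    ∃ D : ℝ, ∀ t : ℝ, Real.exp (K * max 1 |t| ^ σ) ≤ D * Real.exp (|t| ^ τ) := by
  obtain ⟨S, hS⟩ := eventually_atTop.1
    ((tendsto_rpow_atTop (sub_pos.2 hστ)).eventually_ge_atTop K)
  set S' := max 1 S
  refine ⟨Real.exp (|K| * S' ^ σ + 1), fun t => ?_⟩
  rw [← Real.exp_add, Real.exp_le_exp]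
  set s := max 1 |t| with hs
  have hs1 : 1 ≤ s := le_max_left _ _
  have hsσ : 0 ≤ s ^ σ := Real.rpow_nonneg (by linarith) _
  have h1 : s ^ τ ≤ 1 + |t| ^ τ := by
    rcases le_total 1 |t| with h | h
    · rw [hs, max_eq_right h]; linarith
    · rw [hs, max_eq_left h, Real.one_rpow]
      linarith [Real.rpow_nonneg (abs_nonneg t) τ]
  have h2 : 0 ≤ |K| * S' ^ σ := by positivity
  have h3 : 0 ≤ s ^ τ := Real.rpow_nonneg (by linarith) _
  have h4 : K * s ^ σ ≤ |K| * S' ^ σ + s ^ τ := by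
    rcases le_total s S' with h | h
    · have : K * s ^ σ ≤ |K| * S' ^ σ :=
        mul_le_mul (le_abs_self K) (Real.rpow_le_rpow (by linarith) h hσ.le) hsσ (abs_nonneg _)
      linarith
    · have : K * s ^ σ ≤ s ^ τ := by
        calc K * s ^ σ ≤ s ^ (τ - σ) * s ^ σ :=
              mul_le_mul_of_nonneg_right (hS s ((le_max_right _ _).trans h)) hsσ
          _ = s ^ τ := by rw [← Real.rpow_add (by linarith)]; ring_nf
      linarith
  linarith

/-- Exponential growth of `exp (c t)`, in either direction, is not dominated by `exp (|t| ^ τ)`. -/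
theorem eq_zero_of_exp_mul_le {τ : ℝ} (hτ : τ < 1) {c D : ℝ}
    (h : ∀ t : ℝ, Real.exp (c * t) ≤ D * Real.exp (|t| ^ τ)) : c = 0 := by
  have key : ∀ c : ℝ, 0 < c → (∀ t : ℝ, Real.exp (c * t) ≤ D * Real.exp (|t| ^ τ)) → False := by
    intro c hc h
    have hlim : Tendsto (fun t : ℝ => c * t - t ^ τ) atTop atTop := by
      have h1 : Tendsto (fun t : ℝ => c - t ^ (τ - 1)) atTop (𝓝 (c - 0)) := by
        refine tendsto_const_nhds.sub ?_
        have := tendsto_rpow_neg_atTop (sub_pos.2 hτ)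
        simpa using this
      rw [sub_zero] at h1
      refine (tendsto_id.atTop_mul_pos hc h1).congr' ?_
      filter_upwards [eventually_gt_atTop 0] with t ht
      have : t ^ τ = t * t ^ (τ - 1) := by
        rw [Real.rpow_sub_one ht.ne']; field_simp
      simp only [id]
      rw [this]; ring
    obtain ⟨t, ht1, ht2⟩ := ((Real.tendsto_exp_atTop.comp hlim).eventually_gt_atTop D |>.and
      (eventually_gt_atTop 0)).exists
    have h2 := h t
    rw [abs_of_pos ht2] at h2
    simp only [Function.comp, Real.exp_sub] at ht1
    rw [lt_div_iff₀ (Real.exp_pos _)] at ht1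
    linarith
  rcases lt_trichotomy c 0 with hc | hc | hc
  · refine (key (-c) (by linarith) fun t => ?_).elim
    have := h (-t)
    rw [abs_neg] at this
    rwa [neg_mul, ← mul_neg]
  · exact hc
  · exact (key c hc h).elim

/-! ### The one-parameter group of an element of a Banach algebra -/

section OneParam

variable {U V : Type*} [NormedRing U] [NormedAlgebra ℂ U] [NormedRing V] [NormedAlgebra ℂ V]

/-- The one-parameter group `t ↦ e^{itx}` generated by an element of a Banach algebra. By
definition, `expI a` is `oneParam (gen a)`. -/
noncomputable def oneParam (x : U) (t : ℝ) : U := NormedSpace.exp ((Complex.I * t) • x)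

/-- The Bochner integral `(1/2π) ∫ F(t) e^{itx} dt`. By definition, `funCalc f a` is
`fourierCalc f.hat (gen a)`. -/
noncomputable def fourierCalc (F : ℝ → ℂ) (x : U) : U :=
  (1 / (2 * Real.pi) : ℂ) • ∫ t : ℝ, F t • oneParam x t

theorem oneParam_zero (x : U) : oneParam x 0 = 1 := by
  simp [oneParam, NormedSpace.exp_zero]

theorem oneParam_add [CompleteSpace U] (x : U) (s t : ℝ) :
    oneParam x (s + t) = oneParam x s * oneParam x t := by
  let _ : NormedAlgebra ℚ U := NormedAlgebra.restrictScalars ℚ ℂ U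
  rw [oneParam, oneParam, oneParam, ← NormedSpace.exp_add_of_commute]
  · rw [← add_smul]; push_cast; ring_nf
  · exact ((Commute.refl x).smul_left _).smul_right _

theorem oneParam_nat_mul [CompleteSpace U] (x : U) (n : ℕ) (t : ℝ) : oneParam x (n * t) = oneParam x t ^ n := by
  induction n with
  | zero => simp [oneParam_zero]
  | succ n ih => rw [pow_succ, ← ih, ← oneParam_add]; push_cast; ring_nf

theorem continuous_oneParam [CompleteSpace U] (x : U) : Continuous (oneParam x) := by
  let _ : NormedAlgebra ℚ U := NormedAlgebra.restrictScalars ℚ ℂ U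
  exact NormedSpace.exp_continuous.comp (by fun_prop)

theorem oneParam_complex (z : ℂ) (t : ℝ) : oneParam z t = Complex.exp (Complex.I * t * z) := by
  rw [oneParam, ← Complex.exp_eq_exp_ℂ, smul_eq_mul]

theorem map_oneParam [CompleteSpace U] (φ : U →ₐ[ℂ] V) (hφ : Continuous φ) (x : U) (t : ℝ) :
    φ (oneParam x t) = oneParam (φ x) t := by
  let _ : NormedAlgebra ℚ U := NormedAlgebra.restrictScalars ℚ ℂ U
  let _ : NormedAlgebra ℚ V := NormedAlgebra.restrictScalars ℚ ℂ V
  rw [oneParam, oneParam, NormedSpace.map_exp φ hφ, map_smul]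

theorem star_oneParam [StarRing U] [StarModule ℂ U] [ContinuousStar U] {x : U}
    (hx : IsSelfAdjoint x) (t : ℝ) : star (oneParam x t) = oneParam x (-t) := by
  rw [oneParam, oneParam, NormedSpace.star_exp, star_smul, hx.star_eq]
  simp

theorem star_oneParam_mul_self [CompleteSpace U] [StarRing U] [StarModule ℂ U] [ContinuousStar U] {x : U}
    (hx : IsSelfAdjoint x) (t : ℝ) : star (oneParam x t) * oneParam x t = 1 := by
  rw [star_oneParam hx, ← oneParam_add, neg_add_cancel, oneParam_zero]

theorem integrable_smul_oneParam [CompleteSpace U] {F : ℝ → ℂ} {w : ℝ → ℝ} {x : U} {D : ℝ} (hF : Integrable F)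
    (hw : Integrable fun t => ‖F t‖ * w t) (hx : ∀ t, ‖oneParam x t‖ ≤ D * w t) :
    Integrable fun t => F t • oneParam x t := by
  refine (hw.const_mul D).mono' (hF.aestronglyMeasurable.smul
    (continuous_oneParam x).aestronglyMeasurable) (Eventually.of_forall fun t => ?_)
  calc ‖F t • oneParam x t‖ ≤ ‖F t‖ * (D * w t) := by
        rw [norm_smul]; exact mul_le_mul_of_nonneg_left (hx t) (norm_nonneg _)
    _ = D * (‖F t‖ * w t) := by ring

theorem norm_fourierCalc_le {F : ℝ → ℂ} {w : ℝ → ℝ} {x : U} {D : ℝ}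
    (hw : Integrable fun t => ‖F t‖ * w t) (hx : ∀ t, ‖oneParam x t‖ ≤ D * w t) :
    ‖fourierCalc F x‖ ≤ 1 / (2 * Real.pi) * D * ∫ t, ‖F t‖ * w t := by
  have h : ‖∫ t : ℝ, F t • oneParam x t‖ ≤ ∫ t, D * (‖F t‖ * w t) := by
    refine norm_integral_le_of_norm_le (hw.const_mul D) (Eventually.of_forall fun t => ?_)
    rw [norm_smul]
    calc ‖F t‖ * ‖oneParam x t‖ ≤ ‖F t‖ * (D * w t) :=
          mul_le_mul_of_nonneg_left (hx t) (norm_nonneg _)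
      _ = D * (‖F t‖ * w t) := by ring
  have hpi : ‖(1 / (2 * Real.pi) : ℂ)‖ = 1 / (2 * Real.pi) := by
    simp [abs_of_pos Real.pi_pos]
  rw [fourierCalc, norm_smul, hpi, mul_assoc]
  rw [integral_const_mul] at h
  exact mul_le_mul_of_nonneg_left h (by positivity)

theorem fourierCalc_congr {F G : ℝ → ℂ} (h : F =ᵐ[volume] G) (x : U) :
    fourierCalc F x = fourierCalc G x := by
  rw [fourierCalc, fourierCalc]
  congr 1
  refine integral_congr_ae ?_
  filter_upwards [h] with t ht
  rw [ht]

theorem map_fourierCalc [CompleteSpace U] [CompleteSpace V] (φ : U →ₐ[ℂ] V) (hφ : Continuous φ) {F : ℝ → ℂ} {x : U}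
    (hF : Integrable fun t => F t • oneParam x t) :
    φ (fourierCalc F x) = fourierCalc F (φ x) := by
  rw [fourierCalc, fourierCalc, map_smul]
  congr 1
  have h := ContinuousLinearMap.integral_comp_comm (⟨φ.toLinearMap, hφ⟩ : U →L[ℂ] V) hF
  refine h.symm.trans (integral_congr_ae (Eventually.of_forall fun t => ?_))
  change φ (F t • oneParam x t) = _
  rw [map_smul, map_oneParam φ hφ]

theorem fourierCalc_add {F G : ℝ → ℂ} {x : U} (hF : Integrable fun t => F t • oneParam x t)
    (hG : Integrable fun t => G t • oneParam x t) :
    fourierCalc (F + G) x = fourierCalc F x + fourierCalc G x := by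
  simp only [fourierCalc, Pi.add_apply, add_smul]
  rw [integral_add hF hG, smul_add]

theorem fourierCalc_smul (c : ℂ) (F : ℝ → ℂ) (x : U) :
    fourierCalc (c • F) x = c • fourierCalc F x := by
  simp only [fourierCalc, Pi.smul_apply, smul_eq_mul, mul_smul]
  rw [integral_smul, smul_comm]

open scoped Convolution in
/-- Since `t ↦ e^{itx}` is multiplicative, the functions `F(t) e^{itx}` are convolved when the
densities `F` are, so the integral turns convolutions into products. -/
theorem fourierCalc_convolution [CompleteSpace U] {F G : ℝ → ℂ} {x : U}
    (hF : Integrable fun t => F t • oneParam x t) (hG : Integrable fun t => G t • oneParam x t) :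
    fourierCalc ((1 / (2 * Real.pi) : ℂ) • (F ⋆[ContinuousLinearMap.mul ℂ ℂ, volume] G)) x =
      fourierCalc F x * fourierCalc G x := by
  have h := integral_convolution (μ := volume) (ν := volume) (ContinuousLinearMap.mul ℂ U) hF hG
  have h2 : ∀ t, ((fun t => F t • oneParam x t) ⋆[ContinuousLinearMap.mul ℂ U, volume]
      (fun t => G t • oneParam x t)) t =
      (F ⋆[ContinuousLinearMap.mul ℂ ℂ, volume] G) t • oneParam x t := by
    intro t
    rw [convolution_def, convolution_def, ← integral_smul_const]
    refine integral_congr_ae (Eventually.of_forall fun s => ?_)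
    have : oneParam x t = oneParam x s * oneParam x (t - s) := by
      rw [← oneParam_add, add_sub_cancel]
    simp only [ContinuousLinearMap.mul_apply']
    rw [this, smul_mul_smul_comm]
  simp only [h2, ContinuousLinearMap.mul_apply'] at h
  rw [fourierCalc_smul, fourierCalc, fourierCalc, fourierCalc, h, smul_mul_smul_comm, smul_smul]

theorem star_fourierCalc [CompleteSpace U] [StarRing U] [StarModule ℂ U] [ContinuousStar U] {x : U}
    (hx : IsSelfAdjoint x) (F : ℝ → ℂ) :
    star (fourierCalc F x) = fourierCalc (fun t => starRingEnd ℂ (F (-t))) x := by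
  have h := (starL' ℝ : U ≃L[ℝ] U).integral_comp_comm (μ := volume)
    (fun t => F t • oneParam x t)
  have h' : star (∫ t : ℝ, F t • oneParam x t) = ∫ t : ℝ, star (F t • oneParam x t) := h.symm
  rw [fourierCalc, fourierCalc, star_smul, h', ← integral_neg_eq_self]
  congr 1
  · simp
  · refine integral_congr_ae (Eventually.of_forall fun t => ?_)
    simp only [star_smul, star_oneParam hx, neg_neg]
    rfl

end OneParam

/-! ### Spectra in commutative Banach algebras -/

section Spectrum

variable {U : Type*} [NormedRing U] [NormedAlgebra ℂ U] [CompleteSpace U]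

theorem continuous_of_algHom (χ : U →ₐ[ℂ] ℂ) : Continuous χ :=
  χ.toContinuousLinearMap.continuous

theorem mem_spectrum_iff_exists_algHom (hcomm : ∀ x y : U, x * y = y * x) {x : U} {z : ℂ} :
    z ∈ spectrum ℂ x ↔ ∃ χ : U →ₐ[ℂ] ℂ, χ x = z := by
  let _ : NormedCommRing U := { (inferInstance : NormedRing U) with mul_comm := hcomm }
  constructor
  · intro h
    obtain ⟨f, hf⟩ := WeakDual.CharacterSpace.mem_spectrum_iff_exists.1 h
    exact ⟨WeakDual.CharacterSpace.toAlgHom f, hf⟩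
  · rintro ⟨χ, rfl⟩
    exact AlgHom.apply_mem_spectrum χ x

/-- If `‖e^{itx}‖` grows more slowly than every exponential, then `x` has real spectrum: a
character with value `z` at `x` maps `e^{itx}` to a number of modulus `e^{-t Im z}`. -/
theorem im_eq_zero_of_mem_spectrum (hcomm : ∀ x y : U, x * y = y * x) {x : U} {τ D : ℝ}
    (hτ : τ < 1) (hx : ∀ t : ℝ, ‖oneParam x t‖ ≤ D * Real.exp (|t| ^ τ)) {z : ℂ}
    (hz : z ∈ spectrum ℂ x) : z.im = 0 := by
  obtain ⟨χ, rfl⟩ := (mem_spectrum_iff_exists_algHom hcomm).1 hz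
  have h : -(χ x).im = 0 := by
    refine eq_zero_of_exp_mul_le hτ (D := ‖χ.toContinuousLinearMap‖ * D) fun t => ?_
    have h1 : ‖χ (oneParam x t)‖ = Real.exp (-(χ x).im * t) := by
      rw [map_oneParam χ (continuous_of_algHom χ), oneParam_complex, Complex.norm_exp]
      congr 1
      simp
      ring
    rw [← h1, mul_assoc]
    exact (χ.toContinuousLinearMap.le_opNorm _).trans
      (mul_le_mul_of_nonneg_left (hx t) (norm_nonneg _))
  linarith

/-- A commutative Banach `*`-algebra with an injective `*`-homomorphism into a `C*`-algebra is
semisimple. -/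
theorem eq_zero_of_forall_algHom_eq_zero [StarRing U] {E : Type*} [CStarAlgebra E]
    (hcomm : ∀ x y : U, x * y = y * x) (θ : U →⋆ₙₐ[ℂ] E) (hθ : Function.Injective θ) {x : U}
    (hx : ∀ χ : U →ₐ[ℂ] ℂ, χ x = 0) : x = 0 := by
  have hq : quasispectrum ℂ (star x * x) ⊆ {0} := by
    rw [quasispectrum_eq_spectrum_union_zero]
    refine Set.union_subset (fun z hz => ?_) le_rfl
    obtain ⟨χ, rfl⟩ := (mem_spectrum_iff_exists_algHom hcomm).1 hz
    simp [hx χ]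
  have hs : spectrum ℂ (θ (star x * x)) ⊆ {0} :=
    (spectrum_subset_quasispectrum ℂ _).trans
      ((NonUnitalAlgHom.quasispectrum_apply_subset θ _).trans hq)
  have h0 : θ (star x * x) = 0 := by
    have hsa : IsSelfAdjoint (θ (star x * x)) := by
      rw [map_mul, map_star]; exact IsSelfAdjoint.star_mul_self _
    have h := hsa.spectralRadius_eq_nnnorm
    have hr : spectralRadius ℂ (θ (star x * x)) = 0 := by
      refine le_antisymm (iSup₂_le fun z hz => ?_) bot_le
      rw [Set.mem_singleton_iff.1 (hs hz)]; simp
    rw [hr] at h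
    simpa using h.symm
  have h1 : θ x = 0 := by
    rw [map_mul, map_star] at h0
    exact CStarRing.star_mul_self_eq_zero_iff _ |>.1 h0
  exact hθ (h1.trans (map_zero θ).symm)

end Spectrum

/-! ### Representations on Hilbert spaces -/

section Representation

variable {U E : Type*} [NormedRing U] [NormedAlgebra ℂ U] [CompleteSpace U] [StarRing U]
  [StarModule ℂ U] [ContinuousStar U] [CStarAlgebra E]

/-- A unital `*`-homomorphism from a Banach algebra with continuous involution into a
`C*`-algebra is continuous, because the norm of `π(x* x)` is its spectral radius, which is at
most a multiple of `‖x* x‖`. -/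
theorem continuous_of_starAlgHom (π : U →⋆ₐ[ℂ] E) : Continuous π := by
  set M : ℝ := ‖((starL' ℝ : U ≃L[ℝ] U) : U →L[ℝ] U)‖
  have hM : ∀ x : U, ‖star x‖ ≤ M * ‖x‖ := fun x =>
    ((starL' ℝ : U ≃L[ℝ] U) : U →L[ℝ] U).le_opNorm x
  have hM0 : 0 ≤ M := norm_nonneg _
  set c : ℝ := M * ‖(1 : U)‖
  have hsq : ∀ x : U, ‖π x‖ ^ 2 ≤ c * ‖x‖ ^ 2 := by
    intro x
    have hsa : IsSelfAdjoint (π (star x * x)) := by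
      rw [map_mul, map_star]; exact IsSelfAdjoint.star_mul_self _
    have h1 : ‖π (star x * x)‖ ≤ ‖star x * x‖ * ‖(1 : U)‖ := by
      have h2 : spectralRadius ℂ (π (star x * x)) ≤
          ENNReal.ofReal (‖star x * x‖ * ‖(1 : U)‖) := by
        refine iSup₂_le fun z hz => ?_
        have hz' := AlgHom.spectrum_apply_subset π _ hz
        rw [← enorm_eq_nnnorm, ← ofReal_norm z]
        exact ENNReal.ofReal_le_ofReal (spectrum.norm_le_norm_mul_of_mem hz')
      rw [hsa.spectralRadius_eq_nnnorm] at h2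
      have h3 := ENNReal.toReal_mono ENNReal.ofReal_ne_top h2
      rwa [ENNReal.toReal_ofReal (by positivity)] at h3
    calc ‖π x‖ ^ 2 = ‖π (star x * x)‖ := by
          rw [map_mul, map_star, CStarRing.norm_star_mul_self, sq]
      _ ≤ ‖star x * x‖ * ‖(1 : U)‖ := h1
      _ ≤ (M * ‖x‖ * ‖x‖) * ‖(1 : U)‖ := by
          refine mul_le_mul_of_nonneg_right ((norm_mul_le _ _).trans ?_) (norm_nonneg _)
          exact mul_le_mul_of_nonneg_right (hM x) (norm_nonneg _)
      _ = c * ‖x‖ ^ 2 := by ring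
  refine AddMonoidHomClass.continuous_of_bound π (Real.sqrt c) fun x => ?_
  refine le_of_sq_le_sq ?_ (by positivity)
  rw [mul_pow, Real.sq_sqrt (by positivity)]
  exact hsq x

/-- In a `C*`-algebra the integral `(1/2π) ∫ F(t) e^{itx} dt` is the continuous functional
calculus, since both sides are images of one integral in the algebra of continuous functions on
the spectrum. -/
theorem fourierCalc_eq_cfc {x : E} (hx : IsSelfAdjoint x) {F : ℝ → ℂ} (hF : Integrable F) :
    fourierCalc F x = cfc (fun z : ℂ => fourierCalc F ((z.re : ℝ) : ℂ)) x := by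
  have hn : IsStarNormal x := hx.isStarNormal
  set X : C(spectrum ℂ x, ℂ) := (ContinuousMap.id ℂ).restrict (spectrum ℂ x) with hX
  have hre : ∀ z : spectrum ℂ x, ((z : ℂ).re : ℂ) = z := fun z =>
    (hx.mem_spectrum_eq_re z.2).symm
  have hXsa : IsSelfAdjoint X := by
    ext z
    have := hre z
    rw [ContinuousMap.star_apply]
    change star (z : ℂ) = z
    rw [← this]
    exact Complex.conj_ofReal _
  have hint : Integrable fun t => F t • oneParam X t := by
    refine integrable_smul_oneParam (w := fun _ => 1) (D := 1) hF
      (by simpa using hF.norm) fun t => ?_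
    rw [mul_one, ContinuousMap.norm_le _ zero_le_one]
    intro z
    have h : ‖oneParam X t z‖ * ‖oneParam X t z‖ = 1 := by
      have := congrArg (fun f : C(spectrum ℂ x, ℂ) => f z) (star_oneParam_mul_self hXsa t)
      have h2 := congrArg norm this
      simpa using h2
    nlinarith [norm_nonneg (oneParam X t z)]
  have h1 : cfcHom hn (fourierCalc F X) = fourierCalc F x := by
    have := map_fourierCalc (cfcHom (R := ℂ) hn).toAlgHom (cfcHom_continuous hn) hint
    refine this.trans ?_
    congr 1
    exact cfcHom_id hn
  have h2 : ∀ z : spectrum ℂ x, fourierCalc F X z = fourierCalc F (((z : ℂ).re : ℝ) : ℂ) := by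
    intro z
    have := map_fourierCalc (ContinuousMap.evalAlgHom ℂ ℂ z)
      (continuous_eval_const z) hint
    rw [hre z]
    exact this
  have hcont : ContinuousOn (fun z : ℂ => fourierCalc F ((z.re : ℝ) : ℂ)) (spectrum ℂ x) := by
    rw [continuousOn_iff_continuous_domRestrict]
    exact (fourierCalc F X).continuous.congr h2
  rw [cfc_apply _ x hn hcont, ← h1]
  congr 1
  ext z
  exact h2 z

/-- A non-degenerate representation maps the unit to the identity. -/
theorem map_one_of_isNondegenerate {R H : Type*} [Ring R] [Algebra ℂ R]
    [NormedAddCommGroup H] [InnerProductSpace ℂ H] [CompleteSpace H] [Star R]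
    (rep : R →⋆ₙₐ[ℂ] (H →L[ℂ] H)) (h : IsNondegenerate rep) : rep 1 = 1 := by
  have hd : Dense ((Submodule.span ℂ {w : H | ∃ (x : R) (v : H), w = rep x v} : Submodule ℂ H) :
      Set H) := Submodule.dense_iff_topologicalClosure_eq_top.2 h
  refine ContinuousLinearMap.ext_on hd ?_
  rintro _ ⟨x, v, rfl⟩
  rw [← mul_apply_eq_comp, ← map_mul, one_mul]
  rfl

end Representation

/-! ### The elements `e^{ita} - 1` -/

instance continuousStar_starSubalgebra {U : Type*} [TopologicalSpace U] [Ring U] [Algebra ℂ U]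
    [StarRing U] [StarModule ℂ U] [ContinuousStar U] (S : StarSubalgebra ℂ U) :
    ContinuousStar S :=
  ⟨(continuous_star.comp continuous_subtype_val).subtype_mk _⟩

section Growth

theorem nuPow_mem {A : Type*} [NonUnitalNormedRing A] [NormedSpace ℂ A]
    {S : NonUnitalSubalgebra ℂ A} {a : A} (ha : a ∈ S) (n : ℕ) :
    nuPow a n ∈ S := by
  induction n with
  | zero => exact S.zero_mem
  | succ n ih =>
    cases n with
    | zero => exact ha
    | succ n => exact S.mul_mem ih ha

variable {A : Type*} [NonUnitalNormedRing A] [NormedSpace ℂ A] [IsScalarTower ℂ A A]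
  [SMulCommClass ℂ A A] [StarRing A]

theorem isometry_of : Isometry (MinUnitization.of A) :=
  AddMonoidHomClass.isometry_of_norm _ MinUnitization.norm_of

theorem of_nuPow (a : A) (n : ℕ) :
    MinUnitization.of A (nuPow a (n + 1)) = MinUnitization.of A a ^ (n + 1) := by
  induction n with
  | zero => rw [zero_add, pow_one]; rfl
  | succ n ih => rw [pow_succ, ← ih, ← map_mul]; rfl

variable [StarModule ℂ A] [ContinuousStar A]

theorem isSelfAdjoint_gen {a : A} (ha : IsSelfAdjoint a) : IsSelfAdjoint (gen a) :=
  Subtype.ext (ha.map (MinUnitization.of A)).star_eq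

theorem gen_mul_comm {a : A} (ha : IsSelfAdjoint a) (x y : Gen a) : x * y = y * x := by
  have : IsStarNormal (MinUnitization.of A a) := (ha.map (MinUnitization.of A)).isStarNormal
  exact mul_comm x y

theorem coe_expI [CompleteSpace A] (a : A) (t : ℝ) :
    (expI a t : MinUnitization A) = oneParam (MinUnitization.of A a) t :=
  map_oneParam (StarAlgebra.elemental ℂ (MinUnitization.of A a)).subtype.toAlgHom
    continuous_subtype_val (gen a) t

/-- Although the unit need not belong to `A`, the elements `e^{ita} - 1` do: the exponential series
without its constant term converges in the closed subalgebra of `A` generated by `a`. -/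
theorem exists_of_eq_expI_sub_one [CompleteSpace A] (a : A) :
    ∃ v : ℝ → NonUnitalAlgebra.elemental ℂ a, Continuous v ∧
      ∀ t, MinUnitization.of A (v t) = (expI a t : MinUnitization A) - 1 := by
  set S : Set (MinUnitization A) :=
    MinUnitization.of A '' (NonUnitalAlgebra.elemental ℂ a : Set A) with hS
  have hSc : IsClosed S := isometry_of.isClosedEmbedding.isClosedMap _
    (NonUnitalAlgebra.elemental.isClosed ℂ a)
  have hmem : ∀ t : ℝ, (expI a t : MinUnitization A) - 1 ∈ S := by
    intro t
    set y : A := (Complex.I * t) • a with hy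
    have hya : y ∈ NonUnitalAlgebra.elemental ℂ a :=
      SMulMemClass.smul_mem _ (NonUnitalAlgebra.elemental.self_mem ℂ a)
    have hexp : (expI a t : MinUnitization A) = NormedSpace.exp (MinUnitization.of A y) := by
      rw [coe_expI, oneParam, hy, map_smul]
    have hsum := (hasSum_nat_add_iff' 1).2
      (NormedSpace.exp_series_hasSum_exp' (𝕂 := ℂ) (MinUnitization.of A y))
    rw [Finset.sum_range_one, Nat.factorial_zero, Nat.cast_one, inv_one, one_smul, pow_zero,
      ← hexp] at hsum
    refine hSc.mem_of_tendsto hsum (Eventually.of_forall fun s => ?_)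
    refine ⟨∑ n ∈ s, (((n + 1).factorial : ℂ)⁻¹) • nuPow y (n + 1),
      sum_mem fun n _ => SMulMemClass.smul_mem _ (nuPow_mem hya _), ?_⟩
    rw [map_sum]
    refine Finset.sum_congr rfl fun n _ => ?_
    rw [map_smul, of_nuPow]
  choose w hw1 hw2 using hmem
  refine ⟨fun t => ⟨w t, hw1 t⟩, ?_, hw2⟩
  refine Continuous.subtype_mk (isometry_of.isEmbedding.continuous_iff.2 ?_) _
  have : (MinUnitization.of A ∘ w) = fun t => (expI a t : MinUnitization A) - 1 := funext hw2
  rw [this]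
  exact (continuous_subtype_val.comp (continuous_oneParam (gen a))).sub continuous_const

/-! ### Growth of the one-parameter group -/

/-- If `1 + v` is a unitary in some unitization, then `v* v = -(v + v*)`, and the `C*`-identity
gives `‖v‖ ≤ 2`. -/
theorem norm_le_two_of_star_mul_self {B : Type*} [NonUnitalCStarAlgebra B] {b : B}
    (h : star b * b = -(star b + b)) : ‖b‖ ≤ 2 := by
  have h1 : ‖b‖ * ‖b‖ ≤ ‖b‖ + ‖b‖ := by
    rw [← CStarRing.norm_star_mul_self, h, norm_neg]
    exact (norm_add_le _ _).trans_eq (by rw [norm_star])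
  nlinarith [norm_nonneg b]

/-- The binomial expansion of `(u - 1) ^ k`, solved for `u ^ k - 1`. -/
theorem norm_pow_sub_one_le {U : Type*} [NormedRing U] [NormedAlgebra ℂ U] (u : U) (k : ℕ)
    (hk : k ≠ 0) : ‖u ^ k - 1‖ ≤
      ‖(u - 1) ^ k‖ + ∑ i ∈ Finset.range k, (k.choose i : ℝ) * ‖u ^ i - 1‖ := by
  have h1 : ∀ w : U, (w - 1) ^ k =
      ∑ i ∈ Finset.range (k + 1), ((-1) ^ (k - i) * (k.choose i : ℂ)) • w ^ i := by
    intro w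
    rw [sub_eq_add_neg, ((Commute.one_right w).neg_right).add_pow]
    refine Finset.sum_congr rfl fun i _ => ?_
    rw [mul_assoc, Algebra.smul_def, map_mul, map_pow, map_neg, map_one, map_natCast]
    exact (((Commute.neg_one_right (w ^ i)).pow_right _).mul_right (Nat.commute_cast _ _)).eq
  have h2 : (u - 1) ^ k =
      ∑ i ∈ Finset.range (k + 1), ((-1) ^ (k - i) * (k.choose i : ℂ)) • (u ^ i - 1) := by
    have h3 := h1 1
    rw [sub_self, zero_pow hk] at h3
    simp only [one_pow] at h3
    simp only [smul_sub, Finset.sum_sub_distrib, ← h3, sub_zero]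
    exact h1 u
  rw [Finset.sum_range_succ, Nat.sub_self, pow_zero, Nat.choose_self, Nat.cast_one, one_mul,
    one_smul] at h2
  have h4 : u ^ k - 1 = (u - 1) ^ k -
      ∑ i ∈ Finset.range k, ((-1) ^ (k - i) * (k.choose i : ℂ)) • (u ^ i - 1) := by
    rw [h2]; abel
  rw [h4]
  refine (norm_sub_le _ _).trans (add_le_add le_rfl ((norm_sum_le _ _).trans_eq ?_))
  refine Finset.sum_congr rfl fun i _ => ?_
  rw [norm_smul, norm_mul, norm_pow, norm_neg, norm_one, one_pow, one_mul, Complex.norm_natCast]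

/-- The growth of `e^{ita}`. The elements `v(t) = e^{ita} - 1` of `A` have norm at most `2` in `B`,
so the differential inequality bounds `v(t) ^ k` by a multiple of `‖v(t)‖ ^ p`, and
`v(k t) = e^{ikta} - 1` differs from `v(t) ^ k` by a combination of the `v(i t)` with `i < k`. -/
theorem exists_norm_expI_le [CompleteSpace A] {B : Type*} [NonUnitalCStarAlgebra B] {k : ℕ} {p q : ℝ}
    {ι : A →⋆ₙₐ[ℂ] B} (hA : IsDifferentialSubalgebra k p q ι) {τ : ℝ} (hτ0 : 0 < τ) (hτ1 : τ < 1)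
    (hτ : Real.logb k p < τ) {a : A} (ha : IsSelfAdjoint a) :
    ∃ D : ℝ, ∀ t : ℝ, ‖expI a t‖ ≤ D * Real.exp (|t| ^ τ) := by
  obtain ⟨C, hC0, hC⟩ := hA.bound
  obtain ⟨v, hvc, hv⟩ := exists_of_eq_expI_sub_one a
  have hk : (1 : ℝ) < k := by exact_mod_cast hA.two_le
  obtain ⟨σ, hσ, hστ⟩ := exists_between (max_lt hτ hτ0)
  have hσ0 : 0 < σ := (le_max_right _ _).trans_lt hσ
  have hpσ : p < (k : ℝ) ^ σ :=
    (Real.logb_lt_iff_lt_rpow hk hA.p_pos).1 ((le_max_left _ _).trans_lt hσ)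
  have hsa : IsSelfAdjoint (MinUnitization.of A a) := ha.map _
  have hιv : ∀ t, ‖ι (v t : A)‖ ≤ 2 := by
    intro t
    have h1 : star (v t : A) * (v t : A) = -(star (v t : A) + v t) := by
      refine isometry_of.injective ?_
      rw [map_mul, map_star, map_neg, map_add, map_star, hv, coe_expI, star_sub, star_one,
        sub_mul, mul_sub, star_oneParam_mul_self hsa]
      noncomm_ring
    refine norm_le_two_of_star_mul_self ?_
    rw [← map_star, ← map_mul, h1, map_neg, map_add]
  have hvn : ∀ t, ‖v t‖ = ‖(expI a t : MinUnitization A) - 1‖ := fun t => by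
    rw [← hv, MinUnitization.norm_of]; rfl
  have hpow : ∀ (n : ℕ) (t : ℝ), (expI a (n * t) : MinUnitization A) = expI a t ^ n :=
    fun n t => by rw [coe_expI, coe_expI, oneParam_nat_mul]
  have hrec : ∀ t : ℝ, ‖v (k * t)‖ ≤ C * 2 ^ q * ‖v t‖ ^ p +
      ∑ i ∈ Finset.range k, (k.choose i : ℝ) * ‖v (i * t)‖ := by
    intro t
    have h0 := norm_pow_sub_one_le (expI a t : MinUnitization A) k
      (by have := hA.two_le; omega)
    simp only [← hpow, ← hvn] at h0
    refine h0.trans (add_le_add ?_ le_rfl)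
    obtain ⟨n, hn⟩ : ∃ n, k = n + 1 := ⟨k - 1, by have := hA.two_le; omega⟩
    rw [← hv, show MinUnitization.of A (v t) ^ k = MinUnitization.of A (nuPow (v t : A) k) by
      rw [hn, of_nuPow], MinUnitization.norm_of]
    refine (hC _).trans ?_
    calc C * ‖(v t : A)‖ ^ p * ‖ι (v t : A)‖ ^ q ≤ C * ‖(v t : A)‖ ^ p * 2 ^ q :=
          mul_le_mul_of_nonneg_left (Real.rpow_le_rpow (norm_nonneg _) (hιv t) hA.q_pos.le)
            (by positivity)
      _ = C * 2 ^ q * ‖v t‖ ^ p := by rw [mul_right_comm]; rfl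
  obtain ⟨K, hK⟩ := exists_le_exp_of_recursion hA.two_le hA.p_pos hσ0 hpσ (by positivity)
    (fun t => norm_nonneg (v t)) hvc.norm hrec
  obtain ⟨D, hD⟩ := exists_exp_max_rpow_le hσ0 hστ hτ1.le K
  refine ⟨D + ‖(1 : MinUnitization A)‖, fun t => ?_⟩
  have h1 : (1 : ℝ) ≤ Real.exp (|t| ^ τ) := Real.one_le_exp (by positivity)
  calc ‖expI a t‖ = ‖((expI a t : MinUnitization A) - 1) + 1‖ := by rw [sub_add_cancel]; rfl
    _ ≤ ‖v t‖ + ‖(1 : MinUnitization A)‖ := by rw [hvn]; exact norm_add_le _ _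
    _ ≤ D * Real.exp (|t| ^ τ) + ‖(1 : MinUnitization A)‖ * Real.exp (|t| ^ τ) :=
        add_le_add ((hK t).trans (hD t)) (le_mul_of_one_le_right (norm_nonneg _) h1)
    _ = _ := by ring

/-! ### The functional calculus -/

/-- If `∫ F = 0`, then `∫ F(t) e^{ita} dt = ∫ F(t) (e^{ita} - 1) dt` is an integral in the closed
subalgebra of `A` generated by `a`. -/
theorem exists_of_eq_fourierCalc [CompleteSpace A] {a : A} {F : ℝ → ℂ} (hF : Integrable F)
    (hFa : Integrable fun t => F t • oneParam (gen a) t) (h0 : ∫ t, F t = 0) :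
    ∃ b ∈ NonUnitalAlgebra.elemental ℂ a,
      MinUnitization.of A b = ((fourierCalc F (gen a) : Gen a) : MinUnitization A) := by
  obtain ⟨v, hvc, hv⟩ := exists_of_eq_expI_sub_one a
  let _ : NormedSpace ℂ (NonUnitalAlgebra.elemental ℂ a) :=
    { norm_smul_le := fun c x => norm_smul_le c (x : A) }
  let J : Gen a →L[ℂ] MinUnitization A :=
    ⟨(StarAlgebra.elemental ℂ (MinUnitization.of A a)).subtype.toAlgHom.toLinearMap,
      continuous_subtype_val⟩
  let L : NonUnitalAlgebra.elemental ℂ a →L[ℂ] MinUnitization A :=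
    { toFun := fun b => MinUnitization.of A b
      map_add' := fun b c => map_add (MinUnitization.of A) (b : A) c
      map_smul' := fun z b => map_smul (MinUnitization.of A) z (b : A)
      cont := isometry_of.continuous.comp continuous_subtype_val }
  have hLn : ∀ b, ‖L b‖ = ‖b‖ := fun b => MinUnitization.norm_of (b : A)
  have hJi : Integrable fun t => F t • (expI a t : MinUnitization A) := J.integrable_comp hFa
  have h1i : Integrable fun t => F t • (1 : MinUnitization A) := hF.smul_const _
  have hLv : ∀ t, L (F t • v t) = F t • (expI a t : MinUnitization A) - F t • 1 := by
    intro t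
    rw [map_smul, ← smul_sub]
    exact congrArg _ (hv t)
  have hvi : Integrable fun t => F t • v t := by
    refine (hJi.sub h1i).mono (hF.aestronglyMeasurable.smul hvc.aestronglyMeasurable)
      (Eventually.of_forall fun t => ?_)
    rw [← hLn, hLv]
    rfl
  have : CompleteSpace (NonUnitalAlgebra.elemental ℂ a) :=
    (NonUnitalAlgebra.elemental.isClosed ℂ a).completeSpace_coe
  have hint : L (∫ t, F t • v t) = J (∫ t, F t • oneParam (gen a) t) := by
    rw [← L.integral_comp_comm hvi, ← J.integral_comp_comm hFa]
    simp only [hLv]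
    rw [integral_sub hJi h1i, integral_smul_const, h0, zero_smul, sub_zero]
    rfl
  refine ⟨((1 / (2 * Real.pi) : ℂ) • ∫ t, F t • v t : NonUnitalAlgebra.elemental ℂ a),
    Subtype.property _, ?_⟩
  change L ((1 / (2 * Real.pi) : ℂ) • ∫ t, F t • v t) =
    J ((1 / (2 * Real.pi) : ℂ) • ∫ t, F t • oneParam (gen a) t)
  rw [map_smul, map_smul, hint]

/-- The closed subalgebra generated by `a` and `1` embeds in the `C*`-algebra `ℂ ⊕ B`. -/
theorem exists_injective_starHom_unitization {B : Type*} [NonUnitalCStarAlgebra B]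
    (ι : A →⋆ₙₐ[ℂ] B) (hι : Function.Injective ι) (a : A) :
    ∃ θ : Gen a →⋆ₙₐ[ℂ] Unitization ℂ B, Function.Injective θ := by
  let ψ : MinUnitization A →⋆ₙₐ[ℂ] Unitization ℂ A :=
    { toFun := MinUnitization.val
      map_smul' := fun _ _ => rfl
      map_zero' := rfl
      map_add' := fun _ _ => rfl
      map_mul' := fun _ _ => rfl
      map_star' := fun _ => rfl }
  let j : Gen a →⋆ₙₐ[ℂ] MinUnitization A :=
    (StarAlgebra.elemental ℂ (MinUnitization.of A a)).subtype
  refine ⟨((Unitization.starMap ι : _ →⋆ₙₐ[ℂ] _).comp ψ).comp j, ?_⟩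
  exact ((Unitization.starMap_injective hι).comp MinUnitization.val_injective).comp
    Subtype.val_injective

end Growth

/-- The exponents `τ` of the theorem exist because `k - 1 < k` and `p = k - q < k`. -/
theorem IsDifferentialSubalgebra.logb_max_lt_one {A B : Type*} [NonUnitalNormedRing A]
    [NormedSpace ℂ A] [StarRing A] [NonUnitalCStarAlgebra B] {k : ℕ} {p q : ℝ} {ι : A →⋆ₙₐ[ℂ] B}
    (hA : IsDifferentialSubalgebra k p q ι) :
    Real.logb k (max ((k : ℝ) - 1) p) < 1 := by
  have hk : (1 : ℝ) < k := by exact_mod_cast hA.two_le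
  rw [Real.logb_lt_iff_lt_rpow hk (lt_max_of_lt_right hA.p_pos), Real.rpow_one]
  exact max_lt (by linarith) (by linarith [hA.add_eq, hA.q_pos])

theorem IsTauRep.eq_fourierCalc {σ : ℝ} {f F : ℝ → ℂ} (h : IsTauRep σ f F) (x : ℝ) :
    f x = fourierCalc F (x : ℂ) := by
  rw [h.eq_integral, fourierCalc]
  simp only [oneParam_complex, smul_eq_mul]

section Calculus

variable {A : Type*} [NonUnitalNormedRing A] [NormedSpace ℂ A] [IsScalarTower ℂ A A]
  [SMulCommClass ℂ A A] [StarRing A] [StarModule ℂ A] [ContinuousStar A]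
  {τ : Set.Ioo (0 : ℝ) 1} {a : A} {D : ℝ}

theorem funCalc_eq_of_isTauRep {f : DTau τ} {F : ℝ → ℂ} (h : IsTauRep τ f F) :
    funCalc f a = fourierCalc F (gen a) :=
  fourierCalc_congr (f.isTauRep_hat.ae_eq h) _

variable [CompleteSpace A]

theorem IsTauRep.integrable_smul_oneParam {f F : ℝ → ℂ} (h : IsTauRep τ f F)
    (hD : ∀ t : ℝ, ‖expI a t‖ ≤ D * Real.exp (|t| ^ (τ : ℝ))) :
    Integrable fun t => F t • oneParam (gen a) t :=
  KPQ.integrable_smul_oneParam h.integrable h.weighted hD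

theorem algHom_funCalc (hD : ∀ t : ℝ, ‖expI a t‖ ≤ D * Real.exp (|t| ^ (τ : ℝ)))
    (f : DTau τ) (χ : Gen a →ₐ[ℂ] ℂ) (hχ : (χ (gen a)).im = 0) :
    χ (funCalc f a) = f (χ (gen a)).re := by
  have hre : ((χ (gen a)).re : ℂ) = χ (gen a) := Complex.ext rfl (by simp [hχ])
  rw [f.isTauRep_hat.eq_fourierCalc, hre]
  exact map_fourierCalc χ (continuous_of_algHom χ) (f.isTauRep_hat.integrable_smul_oneParam hD)

/-- The functional calculus `f ↦ f(a)` as a `*`-homomorphism, for a self-adjoint `a` whose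
one-parameter group grows at most like `e^{|t|^τ}`. -/
noncomputable def funCalcHom (ha : IsSelfAdjoint a)
    (hD : ∀ t : ℝ, ‖expI a t‖ ≤ D * Real.exp (|t| ^ (τ : ℝ))) : DTau τ →⋆ₙₐ[ℂ] Gen a where
  toFun f := funCalc f a
  map_smul' c f := by
    rw [funCalc_eq_of_isTauRep (f := c • f) (f.isTauRep_hat.smul c), fourierCalc_smul]
    rfl
  map_zero' := by
    rw [funCalc_eq_of_isTauRep (f := 0) IsTauRep.zero]
    simp [fourierCalc]
  map_add' f g := by
    rw [funCalc_eq_of_isTauRep (f := f + g) (f.isTauRep_hat.add g.isTauRep_hat),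
      fourierCalc_add (f.isTauRep_hat.integrable_smul_oneParam hD)
        (g.isTauRep_hat.integrable_smul_oneParam hD)]
    rfl
  map_mul' f g := by
    rw [funCalc_eq_of_isTauRep (f := f * g)
        (f.isTauRep_hat.mul τ.2.1 τ.2.2 g.isTauRep_hat),
      fourierCalc_convolution (f.isTauRep_hat.integrable_smul_oneParam hD)
        (g.isTauRep_hat.integrable_smul_oneParam hD)]
    rfl
  map_star' f := by
    rw [funCalc_eq_of_isTauRep (f := star f) f.isTauRep_hat.star,
      ← star_fourierCalc (isSelfAdjoint_gen ha)]
    rfl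

theorem continuous_funCalcHom (ha : IsSelfAdjoint a)
    (hD : ∀ t : ℝ, ‖expI a t‖ ≤ D * Real.exp (|t| ^ (τ : ℝ))) :
    Continuous (funCalcHom ha hD) :=
  AddMonoidHomClass.continuous_of_bound _ (1 / (2 * Real.pi) * D) fun f =>
    norm_fourierCalc_le f.isTauRep_hat.weighted hD

theorem spectrum_funCalc (ha : IsSelfAdjoint a)
    (hD : ∀ t : ℝ, ‖expI a t‖ ≤ D * Real.exp (|t| ^ (τ : ℝ))) (f : DTau τ) :
    spectrum ℂ (funCalc f a) = f '' realSpec a := by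
  have hcomm := gen_mul_comm ha
  have him : ∀ χ : Gen a →ₐ[ℂ] ℂ, (χ (gen a)).im = 0 := fun χ =>
    im_eq_zero_of_mem_spectrum hcomm τ.2.2 hD (AlgHom.apply_mem_spectrum χ _)
  ext z
  rw [mem_spectrum_iff_exists_algHom hcomm]
  constructor
  · rintro ⟨χ, rfl⟩
    refine ⟨(χ (gen a)).re, ?_, (algHom_funCalc hD f χ (him χ)).symm⟩
    have hre : ((χ (gen a)).re : ℂ) = χ (gen a) := Complex.ext rfl (by simp [him χ])
    rw [realSpec, Set.mem_ofPred_eq, hre]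
    exact AlgHom.apply_mem_spectrum χ _
  · rintro ⟨x, hx, rfl⟩
    obtain ⟨χ, hχ⟩ := (mem_spectrum_iff_exists_algHom hcomm).1 hx
    refine ⟨χ, ?_⟩
    rw [algHom_funCalc hD f χ (him χ), hχ, Complex.ofReal_re]

/-- By semisimplicity `f(a)` is determined by the values of `f` on the spectrum of `a`. -/
theorem funCalc_eq_of_forall_algHom {B : Type*} [NonUnitalCStarAlgebra B] (ι : A →⋆ₙₐ[ℂ] B)
    (hι : Function.Injective ι) (ha : IsSelfAdjoint a)
    (hD : ∀ t : ℝ, ‖expI a t‖ ≤ D * Real.exp (|t| ^ (τ : ℝ))) (g : DTau τ) (y : Gen a)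
    (h : ∀ (χ : Gen a →ₐ[ℂ] ℂ) (x : ℝ), x ∈ realSpec a → χ (gen a) = x → χ y = g x) :
    funCalc g a = y := by
  have hcomm := gen_mul_comm ha
  obtain ⟨θ, hθ⟩ := exists_injective_starHom_unitization ι hι a
  refine sub_eq_zero.1 (eq_zero_of_forall_algHom_eq_zero hcomm θ hθ fun χ => ?_)
  have hmem : χ (gen a) ∈ spectrum ℂ (gen a) := AlgHom.apply_mem_spectrum χ _
  have him := im_eq_zero_of_mem_spectrum hcomm τ.2.2 hD hmem
  have hre : χ (gen a) = ((χ (gen a)).re : ℂ) := Complex.ext rfl (by simp [him])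
  have hmem' : (χ (gen a)).re ∈ realSpec a := by
    rw [realSpec, Set.mem_ofPred_eq, ← hre]; exact hmem
  rw [map_sub, algHom_funCalc hD g χ him, h χ _ hmem' hre, sub_self]

theorem rep_funCalc {H : Type*} [NormedAddCommGroup H] [InnerProductSpace ℂ H] [CompleteSpace H]
    (ha : IsSelfAdjoint a) (hD : ∀ t : ℝ, ‖expI a t‖ ≤ D * Real.exp (|t| ^ (τ : ℝ))) (f : DTau τ)
    (rep : Gen a →⋆ₙₐ[ℂ] (H →L[ℂ] H)) (hrep : IsNondegenerate rep) :
    rep (funCalc f a) = cfc (fun z : ℂ => f z.re) (rep (gen a)) := by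
  let π : Gen a →⋆ₐ[ℂ] (H →L[ℂ] H) :=
    { rep with
      map_one' := map_one_of_isNondegenerate rep hrep
      commutes' := fun c => by
        change rep (algebraMap ℂ (Gen a) c) = _
        rw [Algebra.algebraMap_eq_smul_one, map_smul, map_one_of_isNondegenerate rep hrep,
          Algebra.algebraMap_eq_smul_one] }
  have h := map_fourierCalc π.toAlgHom (continuous_of_starAlgHom π)
    (f.isTauRep_hat.integrable_smul_oneParam hD)
  refine h.trans ?_
  have hsa : IsSelfAdjoint (rep (gen a)) := (isSelfAdjoint_gen ha).map rep
  refine (fourierCalc_eq_cfc hsa f.isTauRep_hat.integrable).trans ?_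
  congr 1
  funext z
  exact (f.isTauRep_hat.eq_fourierCalc z.re).symm

end Calculus

end KPQ

open KPQ
open scoped Topology
theorem mainTheorem4 {A B : Type*} [NonUnitalNormedRing A] [NormedSpace ℂ A]
    [IsScalarTower ℂ A A] [SMulCommClass ℂ A A] [CompleteSpace A] [StarRing A] [StarModule ℂ A]
    [ContinuousStar A] [NonUnitalCStarAlgebra B] (k : ℕ) (p q : ℝ) (ι : A →⋆ₙₐ[ℂ] B)
    (hA : IsDifferentialSubalgebra k p q ι) :
    -- the admissible parameters exist
    (∃ τ : Set.Ioo (0 : ℝ) 1, Real.logb k (max ((k : ℝ) - 1) p) < τ) ∧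
    ∀ τ : Set.Ioo (0 : ℝ) 1, Real.logb k (max ((k : ℝ) - 1) p) < τ →
      ∀ a : A, IsSelfAdjoint a →
        -- growth of the one-parameter group
        (expI a =O[Bornology.cobounded ℝ] fun t : ℝ => Real.exp (|t| ^ (τ : ℝ))) ∧
        (∀ f : DTau τ,
          -- (i) the Bochner integral exists, and lies in `A(a)` if `f(0) = 0`
          MeasureTheory.Integrable (fun t : ℝ => f.hat t • expI a t) ∧
          (f 0 = 0 → ∃ b ∈ NonUnitalAlgebra.elemental ℂ a,
            MinUnitization.of A b = (funCalc f a : MinUnitization A)) ∧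
          -- (ii) compatibility with the continuous functional calculus in representations
          (∀ (H : Type*) [NormedAddCommGroup H] [InnerProductSpace ℂ H] [CompleteSpace H]
            (rep : Gen a →⋆ₙₐ[ℂ] (H →L[ℂ] H)), IsNondegenerate rep →
              rep (funCalc f a) = cfc (fun z : ℂ => f z.re) (rep (gen a))) ∧
          -- (iii) spectral mapping
          spectrum ℂ (funCalc f a) = f '' realSpec a) ∧
        (∀ z ∈ spectrum ℂ (gen a), z.im = 0) ∧
        -- (iv) the homomorphism
        ∃ φ : DTau τ →⋆ₙₐ[ℂ] Gen a, Continuous φ ∧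
          (∀ f : DTau τ, φ f = funCalc f a) ∧
          (∀ g : DTau τ, (∀ᶠ x in 𝓝ˢ (realSpec a), g x = 1) → φ g = 1) ∧
          (∀ g : DTau τ, (∀ᶠ x in 𝓝ˢ (realSpec a), g x = (x : ℂ)) → φ g = gen a) := by
  have hk : (1 : ℝ) < k := by exact_mod_cast hA.two_le
  refine ⟨?_, fun τ hτ a ha => ?_⟩
  · obtain ⟨τ, hτ, hτ1⟩ := exists_between (max_lt hA.logb_max_lt_one zero_lt_one)
    exact ⟨⟨τ, (le_max_right _ _).trans_lt hτ, hτ1⟩, (le_max_left _ _).trans_lt hτ⟩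
  have hpτ : Real.logb k p < τ :=
    (Real.logb_le_logb_of_le hk hA.p_pos (le_max_right _ _)).trans_lt hτ
  obtain ⟨D, hD⟩ := exists_norm_expI_le hA τ.2.1 τ.2.2 hpτ ha
  refine ⟨?_, fun f => ⟨f.isTauRep_hat.integrable_smul_oneParam hD, fun h0 => ?_, ?_,
    spectrum_funCalc ha hD f⟩, fun z hz => ?_, funCalcHom ha hD, continuous_funCalcHom ha hD,
    fun f => rfl, fun g hg => ?_, fun g hg => ?_⟩
  · refine Asymptotics.IsBigO.of_bound D (Filter.Eventually.of_forall fun t => ?_)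
    rw [Real.norm_of_nonneg (Real.exp_pos _).le]
    exact hD t
  · refine exists_of_eq_fourierCalc f.isTauRep_hat.integrable
      (f.isTauRep_hat.integrable_smul_oneParam hD) ?_
    rw [f.isTauRep_hat.eq_integral] at h0
    have hpi : (1 / (2 * Real.pi) : ℂ) ≠ 0 := by simp [Real.pi_ne_zero]
    simpa using (mul_eq_zero.1 h0).resolve_left hpi
  · intro H _ _ _ rep hrep
    exact rep_funCalc ha hD f rep hrep
  · exact im_eq_zero_of_mem_spectrum (gen_mul_comm ha) τ.2.2 hD hz
  · refine funCalc_eq_of_forall_algHom ι hA.injective ha hD g 1 fun χ x hx _ => ?_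
    rw [map_one, hg.self_of_nhdsSet x hx]
  · refine funCalc_eq_of_forall_algHom ι hA.injective ha hD g (gen a) fun χ x hx hχ => ?_
    rw [hχ, hg.self_of_nhdsSet x hx]
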